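/- Let $S_{2n}$ be the star graph with $2n$ leaves joined to one core vertex. In the \emph{two-type system} with symmetric speeds ($p=1/2$) on $S_{2n}$, one particle is initially placed at every leaf, $n$ of the particles being blue and $n$ red. At each step one of the two colours is sampled with probability $1/2$ each, then a particle is chosen uniformly at random among the remaining particles of that colour, and it takes one simple random walk step (to a uniformly chosen neighbouring vertex). If the vertex it reaches contains particles of the other colour, the moving particle and one of these are both removed; particles of the same colour do not interact. In the \emph{one-type system} one particle is initially placed at every leaf, at each step a uniformly chosen remaining particle takes one simple random walk step, and two particles that meet are both removed. Let $T^2_{1/2}(S_{2n})$ and $T^1(S_{2n})$ be the numbers of steps until no particle is left in the two-type and in the one-type system, respectively. As $n\to\infty$, write $f=O(g)$ if $\limsup f/g<\infty$ and $f=\Omega(g)$ if $\liminf f/g>0$. Theorem. For every $n$ the expectations $E T^2_{1/2}(S_{2n})$ and $E T^1(S_{2n})$ are finite, and: (i) for every real $C<(32\pi)^{-1/2}$, $\; E T^2_{1/2}(S_{2n}) - (2n + C\sqrt n) = \Omega(1)$; (ii) there is $c>0$ such that $E T^2_{1/2}(S_{2n}) - (2n + c\sqrt n\,\log n) = O(1)$.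 Moreover, $E T^2_{1/2}(S_{2n}) - E T^1(S_{2n}) = \Omega(\sqrt n)$ and $E T^2_{1/2}(S_{2n}) - E T^1(S_{2n}) = O(\sqrt n\,\log n)$. -/

import Mathlib

open MeasureTheory ProbabilityTheory Filter
open scoped NNReal ENNReal

noncomputable section

/-! ### Homogeneous Markov chains on a discrete state space, and extinction times -/

namespace Annihilation

/-- The transition kernels of the homogeneous chain with one-step law `step`: given the history up to
time `t`, the state at time `t + 1` has law `step` of the state at time `t`. -/
def stepKernel {S : Type*} [MeasurableSpace S] [DiscreteMeasurableSpace S] (step : S → PMF S)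
    (t : ℕ) : Kernel ((_i : Finset.Iic t) → S) S where
  toFun x := (step (x ⟨t, Finset.mem_Iic.2 le_rfl⟩)).toMeasure
  measurable' :=
    (Measurable.of_discrete (f := fun s : S => (step s).toMeasure)).comp
      (measurable_pi_apply (⟨t, Finset.mem_Iic.2 le_rfl⟩ : Finset.Iic t))

instance {S : Type*} [MeasurableSpace S] [DiscreteMeasurableSpace S] (step : S → PMF S) (t : ℕ) :
    IsMarkovKernel (stepKernel step t) :=
  ⟨fun x => PMF.toMeasure.isProbabilityMeasure (step (x ⟨t, Finset.mem_Iic.2 le_rfl⟩))⟩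

/-- The law, on the space of trajectories `ℕ → S`, of the Markov chain with one-step law `step`
started from the state `s₀`. -/
def chainLaw {S : Type*} [MeasurableSpace S] [DiscreteMeasurableSpace S] (step : S → PMF S)
    (s₀ : S) : Measure (ℕ → S) :=
  Kernel.trajMeasure (X := fun _ => S) (Measure.dirac s₀) (fun t => stepKernel step t)

/-- The first time at which a trajectory is in the set `E` (it is `∞` if this never happens). -/
def firstTime {S : Type*} (E : Set S) (ω : ℕ → S) : ℝ≥0∞ :=
  ⨅ (t : ℕ) (_ : ω t ∈ E), (t : ℝ≥0∞)

/-! ### Particle systems on a finite graph -/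

variable {V : Type*} [Fintype V] [DecidableEq V]

/-- The position after one simple random walk step from `x`: a uniformly random neighbour of `x`
(a walker at a vertex without neighbours stays put). -/
def walkStep (G : SimpleGraph V) [DecidableRel G.Adj] (x : V) : PMF V :=
  if h : (G.neighborFinset x).Nonempty then PMF.uniformOfFinset (G.neighborFinset x) h
  else PMF.pure x

/-- States of the one-type system: the set of occupied sites (there is never more than one particle
at a site). -/
structure OneTypeState (V : Type*) where
  occupied : Finset V

instance (V : Type*) : MeasurableSpace (OneTypeState V) := ⊤

instance (V : Type*) : DiscreteMeasurableSpace (OneTypeState V) := ⟨fun _ => trivial⟩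

/-- The outcome of the particle at `x` jumping to `y` in the one-type system: if `y` is occupied by another
particle, then both particles disappear. -/
def OneTypeState.move (s : OneTypeState V) (x y : V) : OneTypeState V :=
  if y ∈ s.occupied.erase x then ⟨(s.occupied.erase x).erase y⟩
  else ⟨insert y (s.occupied.erase x)⟩

/-- One step of the one-type system: a uniformly random particle takes a random walk step. The state
without particles is absorbing. -/
def oneTypeStep (G : SimpleGraph V) [DecidableRel G.Adj] (s : OneTypeState V) :
    PMF (OneTypeState V) :=
  if h : s.occupied.Nonempty then
    (PMF.uniformOfFinset s.occupied h).bind fun x =>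
      (walkStep G x).map fun y => s.move x y
  else PMF.pure s

/-- States of the two-type system: the multisets of the sites of the blue particles and of the sites
of the red particles (the multiplicity of a site is the number of particles there). -/
structure TwoTypeState (V : Type*) where
  blue : Multiset V
  red : Multiset V

instance (V : Type*) : MeasurableSpace (TwoTypeState V) := ⊤

instance (V : Type*) : DiscreteMeasurableSpace (TwoTypeState V) := ⟨fun _ => trivial⟩

/-- The outcome of a blue particle jumping from `x` to `y`: if there is a red particle at `y`, then the
blue particle and one red particle at `y` disappear. -/
def TwoTypeState.moveBlue (s : TwoTypeState V) (x y : V) : TwoTypeState V :=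
  if y ∈ s.red then ⟨s.blue.erase x, s.red.erase y⟩ else ⟨y ::ₘ s.blue.erase x, s.red⟩

/-- The outcome of a red particle jumping from `x` to `y`. -/
def TwoTypeState.moveRed (s : TwoTypeState V) (x y : V) : TwoTypeState V :=
  if y ∈ s.blue then ⟨s.blue.erase y, s.red.erase x⟩ else ⟨s.blue, y ::ₘ s.red.erase x⟩

/-- A uniformly random blue particle takes a random walk step. -/
def blueStep (G : SimpleGraph V) [DecidableRel G.Adj] (s : TwoTypeState V) :
    PMF (TwoTypeState V) :=
  if h : s.blue ≠ 0 then
    (PMF.ofMultiset s.blue h).bind fun x => (walkStep G x).map fun y => s.moveBlue x y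
  else PMF.pure s

/-- A uniformly random red particle takes a random walk step. -/
def redStep (G : SimpleGraph V) [DecidableRel G.Adj] (s : TwoTypeState V) :
    PMF (TwoTypeState V) :=
  if h : s.red ≠ 0 then
    (PMF.ofMultiset s.red h).bind fun x => (walkStep G x).map fun y => s.moveRed x y
  else PMF.pure s

/-- The colour that is sampled: blue (`true`) with probability `p`, red (`false`) with probability
`1 - p`. -/
def colour (p : unitInterval) : PMF Bool :=
  PMF.ofFintype (fun b => if b then ENNReal.ofReal p else ENNReal.ofReal (1 - p)) (by
    have h0 := p.2.1
    have h1 := p.2.2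
    rw [Fintype.sum_bool]
    simp only [if_true, Bool.false_eq_true, if_false]
    rw [← ENNReal.ofReal_add h0 (by linarith)]
    simp)

/-- One step of the two-type system in which blue is sampled with probability `p`. -/
def twoTypeStep (G : SimpleGraph V) [DecidableRel G.Adj] (p : unitInterval) (s : TwoTypeState V) :
    PMF (TwoTypeState V) :=
  (colour p).bind fun b => if b then blueStep G s else redStep G s

/-! ### The star graph with `2n` leaves -/

/-- The vertices of the star graph with `2n` leaves: the core `none`, and `n + n` leaves, of which
the `n` leaves `some (Sum.inl i)` carry a blue particle and the `n` leaves `some (Sum.inr i)` a red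
particle at the start of the two-type system. -/
abbrev StarVertex (n : ℕ) : Type := Option (Fin n ⊕ Fin n)

/-- The star graph with `2n` leaves. -/
abbrev star (n : ℕ) : SimpleGraph (StarVertex n) := SimpleGraph.starGraph none

/-- One particle at every leaf. -/
def oneTypeInit (n : ℕ) : OneTypeState (StarVertex n) := ⟨Finset.univ.erase none⟩

/-- One particle at every leaf, half of them blue and half of them red. -/
def twoTypeInit (n : ℕ) : TwoTypeState (StarVertex n) :=
  ⟨(Finset.univ : Finset (Fin n)).val.map fun i => some (Sum.inl i),
   (Finset.univ : Finset (Fin n)).val.map fun i => some (Sum.inr i)⟩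

/-- The expected number of steps, in `[0, ∞]`, until every particle is annihilated in the one-type
system on the star graph with `2n` leaves. -/
def expectedTimeOne (n : ℕ) : ℝ≥0∞ :=
  ∫⁻ ω, firstTime {s : OneTypeState (StarVertex n) | s.occupied = ∅} ω
    ∂(chainLaw (oneTypeStep (star n)) (oneTypeInit n))

/-- The expected number of steps, in `[0, ∞]`, until every particle is annihilated in the two-type
system on the star graph with `2n` leaves in which blue is sampled with probability `p`. -/
def expectedTimeTwo (p : unitInterval) (n : ℕ) : ℝ≥0∞ :=
  ∫⁻ ω, firstTime {s : TwoTypeState (StarVertex n) | s.blue = 0 ∧ s.red = 0} ω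
    ∂(chainLaw (twoTypeStep (star n) p) (twoTypeInit n))

/-- The value `p = 1/2`: symmetric speeds. -/
def half : unitInterval := ⟨1 / 2, by norm_num, by norm_num⟩

/-! ### The (one-sided) asymptotic notation -/

/-- `f = O(g)` in the sense `limsup f / g < ∞`. -/
def BigO (f g : ℕ → ℝ) : Prop :=
  limsup (fun n => ((f n / g n : ℝ) : EReal)) atTop < ⊤

/-- `f = Ω(g)` in the sense `liminf f / g > 0`. -/
def BigOmega (f g : ℕ → ℝ) : Prop :=
  0 < liminf (fun n => ((f n / g n : ℝ) : EReal)) atTop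

end Annihilation

end

/-!
On the star every particle is at a leaf or at the core, so a pair that is annihilated costs two steps,
unless a particle jumps from the core to a leaf where it meets no partner. Each such wasted jump costs
two additional steps: the one out of the core and the one back to it. Hence both expected times
are `2 * n` plus twice the expected number of wasted jumps, and the theorem compares these numbers.

Both chains are controlled by potentials. If the target set is absorbing, then the expected time to
reach it is at most any function that decreases on average by at least `1` in each step
(`tsum_transition_le`), and at least any bounded function that vanishes on the target and decreases
on average by at most `1` (`le_tsum_transition`).

In the two-type system the state is summarised by the number `m` of particles of each colour and by the
number `k` of particles at the core, which all have the same colour. The particles at the leaves enter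
only through the fraction `q` of the leaves where a particle leaving the core would be annihilated, and
`0 ≤ q ≤ 1 / 2` because at most `n` of the `2 * n` leaves hold the other colour. While `k ≥ 1`, the
mean increment of `k ^ 2` is `1 - 2 * k ^ 2 / m` and that of `k` is `-k / m`, whatever `q` is.

* Upper bound (`expectedTimeTwo_half_le`). A wasted jump has probability at most `k / (2 * m)`, which
  is at most `k ^ 2 / (4 * m * r) + r / (4 * m)` for every `r > 0`. The drift of `k ^ 2 / (8 * r)` pays
  for the first summand, a harmonic sum in `m` for the second one, and a linear function of `m` for
  the remaining constants. For `r = √n` this gives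
  `2 * n + 2 * √n + √n * log n + 1` (`toReal_expectedTimeTwo_le`).
* Lower bound (`le_expectedTimeTwo_half`). A wasted jump has probability at least `k / (4 * m)`. The
  drift of `k` shows that these probabilities add up on average to at least a quarter of the number of
  visits to an empty core. To bound those, `(K - k)⁺ ^ 2 - (n - m)` is used, with `K ^ 2 ≤ n`: while it
  is positive and the core is occupied, it increases on average, and each visit to the empty core lowers
  it by at most `2 * K`. For `K = ⌊√n⌋` this gives `2 * n + K / 4`, and `1 / 4 > (32 * π) ^ (-1 / 2)`.

In the one-type system the core holds at most one particle, which is sampled with probability `1 / N`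
when there are `N` particles. The expected number of wasted jumps is therefore bounded by a harmonic sum,
and the expected time lies between `2 * n` and `2 * n + O(log n)`
(`le_expectedTimeOne`, `expectedTimeOne_le`).
-/

namespace Annihilation

/-! ### Expectations under a discrete law -/


/-- The expectation, in `[0, ∞]`, of `f` under the discrete law `p`. -/
noncomputable def pmfExp {α : Type*} (p : PMF α) (f : α → ℝ≥0∞) : ℝ≥0∞ := ∑' a, p a * f a

section pmfExp

variable {α β : Type*}

lemma lintegral_toMeasure [MeasurableSpace α] [DiscreteMeasurableSpace α] (p : PMF α)
    (f : α → ℝ≥0∞) : ∫⁻ a, f a ∂p.toMeasure = pmfExp p f := by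
  have h : p.toMeasure = Measure.sum fun a => p a • Measure.dirac a := by
    ext s hs
    rw [PMF.toMeasure_apply p hs, Measure.sum_apply _ hs]
    refine tsum_congr fun a => ?_
    by_cases ha : a ∈ s <;> simp [Measure.dirac_apply' a hs, ha]
  rw [h, lintegral_sum_measure]
  refine tsum_congr fun a => ?_
  rw [lintegral_smul_measure, lintegral_dirac' _ (Measurable.of_discrete), smul_eq_mul]

lemma pmfExp_mono {p : PMF α} {f g : α → ℝ≥0∞} (h : ∀ a ∈ p.support, f a ≤ g a) :
    pmfExp p f ≤ pmfExp p g := by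
  refine ENNReal.tsum_le_tsum fun a => ?_
  by_cases ha : p a = 0
  · simp [ha]
  · gcongr
    exact h a ((p.mem_support_iff a).2 ha)

lemma pmfExp_congr {p : PMF α} {f g : α → ℝ≥0∞} (h : ∀ a ∈ p.support, f a = g a) :
    pmfExp p f = pmfExp p g :=
  le_antisymm (pmfExp_mono fun a ha => (h a ha).le) (pmfExp_mono fun a ha => (h a ha).ge)

lemma pmfExp_add (p : PMF α) (f g : α → ℝ≥0∞) :
    pmfExp p (fun a => f a + g a) = pmfExp p f + pmfExp p g := by
  simp only [pmfExp, mul_add, ENNReal.tsum_add]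

lemma pmfExp_const_mul (p : PMF α) (c : ℝ≥0∞) (f : α → ℝ≥0∞) :
    pmfExp p (fun a => c * f a) = c * pmfExp p f := by
  simp only [pmfExp, mul_left_comm _ c, ENNReal.tsum_mul_left]

lemma pmfExp_const (p : PMF α) (c : ℝ≥0∞) : pmfExp p (fun _ => c) = c := by
  simp [pmfExp, ENNReal.tsum_mul_right, p.tsum_coe]

lemma pmfExp_pure (a : α) (f : α → ℝ≥0∞) : pmfExp (PMF.pure a) f = f a := by
  rw [pmfExp, tsum_eq_single a (fun b hb => by simp [PMF.pure_apply, hb])]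
  simp

lemma pmfExp_bind (p : PMF α) (g : α → PMF β) (f : β → ℝ≥0∞) :
    pmfExp (p.bind g) f = pmfExp p fun a => pmfExp (g a) f := by
  simp only [pmfExp, PMF.bind_apply, ← ENNReal.tsum_mul_right, ← ENNReal.tsum_mul_left, mul_assoc]
  exact ENNReal.tsum_comm

lemma pmfExp_map (p : PMF α) (g : α → β) (f : β → ℝ≥0∞) :
    pmfExp (p.map g) f = pmfExp p fun a => f (g a) := by
  rw [PMF.map, pmfExp_bind]
  simp [pmfExp_pure]

lemma pmfExp_uniformOfFinset (s : Finset α) (hs : s.Nonempty) (f : α → ℝ≥0∞) :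
    pmfExp (PMF.uniformOfFinset s hs) f = (s.card : ℝ≥0∞)⁻¹ * ∑ a ∈ s, f a := by
  rw [pmfExp, tsum_eq_sum (s := s) (fun a ha => by simp [PMF.uniformOfFinset_apply, ha]),
    Finset.mul_sum]
  exact Finset.sum_congr rfl fun a ha => by rw [PMF.uniformOfFinset_apply_of_mem hs ha]

lemma pmfExp_ofMultiset (s : Multiset α) (hs : s ≠ 0) (f : α → ℝ≥0∞) :
    pmfExp (PMF.ofMultiset s hs) f = (Multiset.card s : ℝ≥0∞)⁻¹ * (s.map f).sum := by
  classical
  rw [pmfExp, tsum_eq_sum (s := s.toFinset)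
    (fun a ha => by
      rw [PMF.ofMultiset_apply_of_notMem hs (by simpa using ha), zero_mul]),
    Finset.sum_multiset_map_count, Finset.mul_sum]
  refine Finset.sum_congr rfl fun a ha => ?_
  rw [PMF.ofMultiset_apply, nsmul_eq_mul, div_eq_mul_inv, mul_comm (Multiset.count a s : ℝ≥0∞),
    mul_assoc]

lemma mem_support_ofMultiset {s : Multiset α} {hs : s ≠ 0} {a : α} :
    a ∈ (PMF.ofMultiset s hs).support ↔ a ∈ s := by
  classical
  rw [PMF.mem_support_ofMultiset_iff, Multiset.mem_toFinset]

lemma sum_map_of_eq_or_ne [DecidableEq α] (s : Multiset α) (c : α) (g : α → ℝ≥0∞)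
    (u v : ℝ≥0∞) (hu : c ∈ s → g c = u) (hv : ∀ x ∈ s, x ≠ c → g x = v) :
    (s.map g).sum = (s.count c : ℝ≥0∞) * u + ((Multiset.card s - s.count c : ℕ) : ℝ≥0∞) * v := by
  induction s using Multiset.induction with
  | empty => simp
  | cons a s ih =>
    rw [Multiset.map_cons, Multiset.sum_cons, Multiset.card_cons,
      ih (fun h => hu (Multiset.mem_cons_of_mem h)) fun x hx => hv x (Multiset.mem_cons_of_mem hx)]
    by_cases h : a = c
    · subst h
      rw [hu (Multiset.mem_cons_self _ _), Multiset.count_cons_self, Nat.add_sub_add_right]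
      push_cast
      ring
    · have := Multiset.count_le_card c s
      rw [hv a (Multiset.mem_cons_self _ _) h, Multiset.count_cons_of_ne (Ne.symm h),
        Nat.sub_add_comm this]
      push_cast
      ring

end pmfExp

/-! ### Expected extinction times of Markov chains -/

section Chain

variable {S : Type*}

/-- The transition operator of the chain with one-step law `step`. -/
noncomputable def transition (step : S → PMF S) (f : S → ℝ≥0∞) (s : S) : ℝ≥0∞ :=
  pmfExp (step s) f

/-- For a trajectory that never leaves `E`, the first time in `E` is the number of times outside of `E`. -/
lemma firstTime_eq_tsum {E : Set S} {ω : ℕ → S} (h : ∀ t, ω t ∈ E → ω (t + 1) ∈ E) :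
    firstTime E ω = ∑' t, Eᶜ.indicator 1 (ω t) := by
  classical
  by_cases hE : ∃ t, ω t ∈ E
  · have hmem : ∀ t, ω t ∈ E ↔ Nat.find hE ≤ t := fun t => by
      refine ⟨fun ht => Nat.find_min' hE ht, fun ht => ?_⟩
      induction t, ht using Nat.le_induction with
      | base => exact Nat.find_spec hE
      | succ t _ ih => exact h t ih
    have h1 : firstTime E ω = Nat.find hE := by
      refine le_antisymm (iInf₂_le (Nat.find hE) (Nat.find_spec hE)) (le_iInf₂ fun t ht => ?_)
      exact_mod_cast (hmem t).1 ht
    rw [h1, tsum_eq_sum (s := Finset.range (Nat.find hE))]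
    · rw [Finset.sum_congr rfl (g := fun _ => 1)]
      · simp
      · intro t ht
        have : ω t ∈ Eᶜ := fun h' => absurd ((hmem t).1 h') (by simpa using ht)
        simp [this]
    · intro t ht
      have : ω t ∈ E := (hmem t).2 (by simpa using ht)
      simp [this]
  · push Not at hE
    have h1 : firstTime E ω = ⊤ := by simp [firstTime, hE]
    have h2 : ∀ t, Eᶜ.indicator (1 : S → ℝ≥0∞) (ω t) = 1 := fun t => by simp [hE t]
    simp [h1, h2]

section Law

variable [MeasurableSpace S] [DiscreteMeasurableSpace S]

instance (step : S → PMF S) (s₀ : S) : IsProbabilityMeasure (chainLaw step s₀) := by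
  unfold chainLaw; infer_instance

lemma lintegral_chainLaw_zero (step : S → PMF S) (s₀ : S) (f : S → ℝ≥0∞) :
    ∫⁻ ω, f (ω 0) ∂chainLaw step s₀ = f s₀ := by
  have hf : Measurable f := Measurable.of_discrete
  have h : (chainLaw step s₀).map (Preorder.frestrictLe 0) =
      (Measure.dirac s₀).map (MeasurableEquiv.piUnique (fun _ : Finset.Iic 0 => S)).symm := by
    rw [chainLaw, Kernel.trajMeasure, Measure.map_comp _ _ (by fun_prop),
      Kernel.traj_map_frestrictLe, Kernel.partialTraj_self, Measure.id_comp]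
  have hg : Measurable fun x : (_i : Finset.Iic 0) → S => f (x ⟨0, Finset.mem_Iic.2 le_rfl⟩) :=
    hf.comp (measurable_pi_apply _)
  calc ∫⁻ ω, f (ω 0) ∂chainLaw step s₀
      = ∫⁻ x, f (x ⟨0, Finset.mem_Iic.2 le_rfl⟩)
          ∂(chainLaw step s₀).map (Preorder.frestrictLe 0) := by
        rw [lintegral_map hg (by fun_prop)]; rfl
    _ = f s₀ := by
        rw [h, lintegral_map hg (by fun_prop),
          lintegral_dirac' s₀ Measurable.of_discrete]
        rfl

/-- The Markov property, for functions of two consecutive states. -/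
lemma lintegral_chainLaw_succ (step : S → PMF S) (s₀ : S) (t : ℕ) (g f : S → ℝ≥0∞) :
    ∫⁻ ω, g (ω t) * f (ω (t + 1)) ∂chainLaw step s₀ =
      ∫⁻ ω, g (ω t) * transition step f (ω t) ∂chainLaw step s₀ := by
  have hf : Measurable f := Measurable.of_discrete
  have hg : Measurable g := Measurable.of_discrete
  have hP : Measurable (transition step f) := Measurable.of_discrete
  have he : Measurable fun x : (_i : Finset.Iic t) → S => x ⟨t, Finset.mem_Iic.2 le_rfl⟩ :=
    measurable_pi_apply _
  have key := Kernel.map_frestrictLe_trajMeasure_compProd_eq_map_trajMeasure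
    (X := fun _ => S) (μ₀ := Measure.dirac s₀) (κ := fun t => stepKernel step t) (a := t)
  have hG : Measurable fun p : ((_i : Finset.Iic t) → S) × S =>
      g (p.1 ⟨t, Finset.mem_Iic.2 le_rfl⟩) * f p.2 :=
    (hg.comp (he.comp measurable_fst)).mul (hf.comp measurable_snd)
  calc ∫⁻ ω, g (ω t) * f (ω (t + 1)) ∂chainLaw step s₀
      = ∫⁻ p, g (p.1 ⟨t, Finset.mem_Iic.2 le_rfl⟩) * f p.2 ∂(chainLaw step s₀).map
          (fun x => (Preorder.frestrictLe t x, x (t + 1))) := by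
        rw [lintegral_map hG (by fun_prop)]; rfl
    _ = ∫⁻ x, g (x ⟨t, Finset.mem_Iic.2 le_rfl⟩) *
          transition step f (x ⟨t, Finset.mem_Iic.2 le_rfl⟩)
          ∂(chainLaw step s₀).map (Preorder.frestrictLe t) := by
        rw [chainLaw, ← key, Measure.lintegral_compProd hG]
        refine lintegral_congr fun x => ?_
        dsimp only
        rw [lintegral_const_mul _ hf, transition, ← lintegral_toMeasure]
        rfl
    _ = _ := by
        have hm : Measurable fun x : (_i : Finset.Iic t) → S =>
            g (x ⟨t, Finset.mem_Iic.2 le_rfl⟩) *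
              transition step f (x ⟨t, Finset.mem_Iic.2 le_rfl⟩) :=
          (hg.comp he).mul (hP.comp he)
        rw [lintegral_map hm (by fun_prop)]; rfl

lemma lintegral_chainLaw (step : S → PMF S) (s₀ : S) (t : ℕ) (f : S → ℝ≥0∞) :
    ∫⁻ ω, f (ω t) ∂chainLaw step s₀ = (transition step)^[t] f s₀ := by
  induction t generalizing f with
  | zero => exact lintegral_chainLaw_zero step s₀ f
  | succ t ih =>
    rw [Function.iterate_succ_apply, ← ih]
    simpa using lintegral_chainLaw_succ step s₀ t 1 f

/-- If the target set is absorbing, then the expected time to reach it is the sum over all times `t`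
of the probability of being outside of it at time `t`. -/
lemma lintegral_firstTime (step : S → PMF S) (s₀ : S) {E : Set S}
    (hE : ∀ s ∈ E, step s = PMF.pure s) :
    ∫⁻ ω, firstTime E ω ∂chainLaw step s₀ =
      ∑' t, (transition step)^[t] (Eᶜ.indicator 1) s₀ := by
  have hmeas : ∀ f : S → ℝ≥0∞, ∀ t, Measurable fun ω : ℕ → S => f (ω t) := fun f t =>
    (Measurable.of_discrete (f := f)).comp (measurable_pi_apply t)
  have habs : ∀ᵐ ω ∂chainLaw step s₀, ∀ t, ω t ∈ E → ω (t + 1) ∈ E := by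
    refine ae_all_iff.2 fun t => ?_
    have h0 : ∫⁻ ω, E.indicator (1 : S → ℝ≥0∞) (ω t) * Eᶜ.indicator 1 (ω (t + 1))
        ∂chainLaw step s₀ = 0 := by
      rw [lintegral_chainLaw_succ, ← lintegral_zero (μ := chainLaw step s₀)]
      refine lintegral_congr fun ω => ?_
      by_cases h : ω t ∈ E
      · simp [transition, hE _ h, pmfExp_pure, h]
      · simp [h]
    have hm : Measurable fun ω : ℕ → S =>
        E.indicator (1 : S → ℝ≥0∞) (ω t) * Eᶜ.indicator 1 (ω (t + 1)) :=
      (hmeas _ t).mul (hmeas _ (t + 1))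
    rw [lintegral_eq_zero_iff hm] at h0
    filter_upwards [h0] with ω hω h1
    by_contra h2
    simp [h1, h2] at hω
  rw [lintegral_congr_ae (habs.mono fun ω hω => firstTime_eq_tsum hω),
    lintegral_tsum fun t => (hmeas _ t).aemeasurable]
  exact tsum_congr fun t => lintegral_chainLaw step s₀ t _

end Law

variable {step : S → PMF S} {E I : Set S} {s₀ : S}

lemma transition_sum (step : S → PMF S) (f : ℕ → S → ℝ≥0∞) (N : ℕ) (s : S) :
    transition step (fun s => ∑ t ∈ Finset.range N, f t s) s =
      ∑ t ∈ Finset.range N, transition step (f t) s := by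
  induction N with
  | zero => simp [transition, pmfExp_const]
  | succ N ih =>
    simp only [Finset.sum_range_succ, ← ih]
    exact pmfExp_add _ _ _

lemma sum_range_succ_transition (step : S → PMF S) (f : S → ℝ≥0∞) (N : ℕ) (s : S) :
    ∑ t ∈ Finset.range (N + 1), (transition step)^[t] f s =
      f s + transition step (fun s => ∑ t ∈ Finset.range N, (transition step)^[t] f s) s := by
  rw [Finset.sum_range_succ', add_comm, transition_sum]
  simp only [Function.iterate_zero, id, Function.iterate_succ_apply']

/-- A supersolution on an invariant set `I` bounds the expected occupation time of `Eᶜ` from above. -/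
lemma tsum_transition_le (hI : ∀ s ∈ I, ∀ s' ∈ (step s).support, s' ∈ I) {Ψ : S → ℝ≥0∞}
    (hΨ : ∀ s ∈ I, Eᶜ.indicator 1 s + transition step Ψ s ≤ Ψ s) (hs : s₀ ∈ I) :
    ∑' t, (transition step)^[t] (Eᶜ.indicator 1) s₀ ≤ Ψ s₀ := by
  have h : ∀ N, ∀ s ∈ I,
      ∑ t ∈ Finset.range N, (transition step)^[t] (Eᶜ.indicator 1) s ≤ Ψ s := by
    intro N
    induction N with
    | zero => simp
    | succ N ih =>
      intro s hs
      rw [sum_range_succ_transition]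
      refine le_trans ?_ (hΨ s hs)
      gcongr
      exact pmfExp_mono fun s' hs' => ih s' (hI s hs s' hs')
  rw [ENNReal.tsum_eq_iSup_nat]
  exact iSup_le fun N => h N s₀ hs

/-- A bounded subsolution on an invariant set `I` that vanishes on `E` bounds the expected occupation
time of `Eᶜ` from below. -/
lemma le_tsum_transition (hI : ∀ s ∈ I, ∀ s' ∈ (step s).support, s' ∈ I) {Φ : S → ℝ≥0∞}
    {B : ℝ≥0∞} (hB : B ≠ ⊤) (hΦB : ∀ s ∈ I, Φ s ≤ B * Eᶜ.indicator 1 s)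
    (hΦ : ∀ s ∈ I, Φ s ≤ Eᶜ.indicator 1 s + transition step Φ s) (hs : s₀ ∈ I) :
    Φ s₀ ≤ ∑' t, (transition step)^[t] (Eᶜ.indicator 1) s₀ := by
  have h : ∀ N, ∀ s ∈ I,
      Φ s ≤ (∑ t ∈ Finset.range N, (transition step)^[t] (Eᶜ.indicator 1) s) +
        B * (transition step)^[N] (Eᶜ.indicator 1) s := by
    intro N
    induction N with
    | zero => intro s hs; simpa using hΦB s hs
    | succ N ih =>
      intro s hs
      refine (hΦ s hs).trans ?_
      rw [sum_range_succ_transition, add_assoc, Function.iterate_succ_apply']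
      gcongr
      refine (pmfExp_mono fun s' hs' => ih s' (hI s hs s' hs')).trans_eq ?_
      rw [pmfExp_add, pmfExp_const_mul]
      rfl
  by_cases htop : ∑' t, (transition step)^[t] (Eᶜ.indicator 1) s₀ = ⊤
  · simp [htop]
  · have h0 := ENNReal.tendsto_atTop_zero_of_tsum_ne_top htop
    have h1 : Tendsto (fun N => (∑' t, (transition step)^[t] (Eᶜ.indicator 1) s₀) +
        B * (transition step)^[N] (Eᶜ.indicator 1) s₀) atTop
        (nhds ((∑' t, (transition step)^[t] (Eᶜ.indicator 1) s₀) + B * 0)) :=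
      tendsto_const_nhds.add (ENNReal.Tendsto.const_mul h0 (Or.inr hB))
    rw [mul_zero, add_zero] at h1
    refine ge_of_tendsto' h1 fun N => (h N s₀ hs).trans ?_
    gcongr
    exact ENNReal.sum_le_tsum _

end Chain

/-! ### Random walk steps on the star graph -/

section Star

variable {n : ℕ}

lemma neighborFinset_star_leaf {x : StarVertex n} (hx : x ≠ none) :
    (star n).neighborFinset x = {none} := by
  ext y
  simp only [SimpleGraph.mem_neighborFinset, SimpleGraph.starGraph_adj, Finset.mem_singleton]
  grind

lemma neighborFinset_star_core : (star n).neighborFinset none = Finset.univ.erase none := by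
  ext y
  simp [eq_comm]

lemma card_leaves : (Finset.univ.erase (none : StarVertex n)).card = 2 * n := by
  simp [two_mul]

lemma nonempty_leaves (hn : n ≠ 0) : (Finset.univ.erase (none : StarVertex n)).Nonempty := by
  rw [← Finset.card_pos, card_leaves]; omega

lemma walkStep_star_leaf {x : StarVertex n} (hx : x ≠ none) :
    walkStep (star n) x = PMF.pure none := by
  have h : ((star n).neighborFinset x).Nonempty := by simp [neighborFinset_star_leaf hx]
  rw [walkStep, dif_pos h]
  ext y
  by_cases hy : y = none <;>
    simp [PMF.uniformOfFinset_apply, neighborFinset_star_leaf hx, hy]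

lemma walkStep_star_core (hn : n ≠ 0) :
    walkStep (star n) none =
      PMF.uniformOfFinset (Finset.univ.erase none) (nonempty_leaves hn) := by
  have h : ((star n).neighborFinset none).Nonempty := by
    rw [neighborFinset_star_core]; exact nonempty_leaves hn
  rw [walkStep, dif_pos h]
  congr 1
  exact neighborFinset_star_core

/-- Averaging over the leaves a function that takes one value on the leaves satisfying `P` and another
value on the other leaves. -/
lemma pmfExp_walkStep_star_core (hn : n ≠ 0) (P : StarVertex n → Prop) [DecidablePred P]
    {f : StarVertex n → ℝ≥0∞} {u v : ℝ} (hu : 0 ≤ u) (hv : 0 ≤ v)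
    (hfu : ∀ y ≠ none, P y → f y = ENNReal.ofReal u)
    (hfv : ∀ y ≠ none, ¬ P y → f y = ENNReal.ofReal v) :
    pmfExp (walkStep (star n) none) f =
      ENNReal.ofReal (((Finset.univ.erase none).filter P).card / (2 * n) * u +
        (1 - ((Finset.univ.erase none).filter P).card / (2 * n)) * v) := by
  set a := ((Finset.univ.erase (none : StarVertex n)).filter P).card with ha
  set b := ((Finset.univ.erase (none : StarVertex n)).filter fun y => ¬ P y).card with hb
  have hab : a + b = 2 * n := by
    rw [ha, hb, Finset.card_filter_add_card_filter_not, card_leaves]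
  have hab' : (a : ℝ) + b = 2 * n := by exact_mod_cast hab
  have hn' : (0 : ℝ) < n := by exact_mod_cast Nat.pos_of_ne_zero hn
  rw [walkStep_star_core hn, pmfExp_uniformOfFinset, card_leaves,
    ← Finset.sum_filter_add_sum_filter_not _ P,
    Finset.sum_congr rfl (g := fun _ => ENNReal.ofReal u)
      (fun y hy => by
        simp only [Finset.mem_filter, Finset.mem_erase] at hy
        exact hfu y hy.1.1 hy.2),
    Finset.sum_congr (s₁ := Finset.filter (fun y => ¬ P y) _) rfl (g := fun _ => ENNReal.ofReal v)
      (fun y hy => by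
        simp only [Finset.mem_filter, Finset.mem_erase] at hy
        exact hfv y hy.1.1 hy.2),
    Finset.sum_const, Finset.sum_const, nsmul_eq_mul, nsmul_eq_mul, ← ha, ← hb]
  have h1 : (a / (2 * n) * u + (1 - a / (2 * n)) * v : ℝ) =
      ((2 * n : ℕ) : ℝ)⁻¹ * (a * u + b * v) := by
    rw [eq_sub_of_add_eq' hab']
    push_cast
    field_simp
  rw [h1, ENNReal.ofReal_mul (by positivity), ENNReal.ofReal_add (by positivity) (by positivity),
    ENNReal.ofReal_mul (by positivity), ENNReal.ofReal_mul (by positivity),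
    ENNReal.ofReal_inv_of_pos (by push_cast; positivity)]
  simp only [ENNReal.ofReal_natCast]

end Star

/-! ### The two-type system on the star graph -/

section TwoType

variable {n : ℕ}

/-- The states that the two-type system on the star can reach: as many blue as red particles, at most
`n` of each, and not both colours at the core. -/
def twoTypeInvariant (n : ℕ) : Set (TwoTypeState (StarVertex n)) :=
  {s | Multiset.card s.blue = Multiset.card s.red ∧ Multiset.card s.blue ≤ n ∧
    (s.blue.count none = 0 ∨ s.red.count none = 0)}

/-- A function of the number of blue particles and of the number of particles at the core, seen as
a function of the state with values in `[0, ∞]`. -/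
noncomputable def twoTypePotential (f : ℕ → ℕ → ℝ) (s : TwoTypeState (StarVertex n)) : ℝ≥0∞ :=
  ENNReal.ofReal (f (Multiset.card s.blue) (s.blue.count none + s.red.count none))

/-- Exchange of the two colours. -/
def TwoTypeState.swap {V : Type*} (s : TwoTypeState V) : TwoTypeState V := ⟨s.red, s.blue⟩

lemma redStep_eq {V : Type*} [Fintype V] [DecidableEq V] (G : SimpleGraph V) [DecidableRel G.Adj]
    (s : TwoTypeState V) : redStep G s = (blueStep G s.swap).map TwoTypeState.swap := by
  have hmove : ∀ x y, s.moveRed x y = (s.swap.moveBlue x y).swap := by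
    intro x y
    by_cases h : y ∈ s.blue <;>
      simp [TwoTypeState.moveRed, TwoTypeState.moveBlue, TwoTypeState.swap, h]
  by_cases h : s.red ≠ 0
  · have h' : s.swap.blue ≠ 0 := h
    rw [redStep, blueStep, dif_pos h, dif_pos h', PMF.map_bind]
    simp only [PMF.map_comp, Function.comp_def, ← hmove]
    rfl
  · have h' : ¬ s.swap.blue ≠ 0 := h
    rw [redStep, blueStep, dif_neg h, dif_neg h', PMF.pure_map]
    rfl

lemma swap_mem_twoTypeInvariant {s : TwoTypeState (StarVertex n)} (hs : s ∈ twoTypeInvariant n) :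
    s.swap ∈ twoTypeInvariant n :=
  ⟨hs.1.symm, hs.1 ▸ hs.2.1, hs.2.2.symm⟩

lemma twoTypePotential_swap (f : ℕ → ℕ → ℝ) {s : TwoTypeState (StarVertex n)}
    (hs : s ∈ twoTypeInvariant n) : twoTypePotential f s.swap = twoTypePotential f s := by
  simp only [twoTypePotential, TwoTypeState.swap, hs.1, add_comm]

/-- A blue particle that jumps to a core held by red particles is annihilated there. -/
lemma moveBlue_leaf_of_mem {s : TwoTypeState (StarVertex n)} (hs : s ∈ twoTypeInvariant n)
    {x : StarVertex n} (hx : x ∈ s.blue) (hx0 : x ≠ none) (hr : none ∈ s.red) :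
    s.moveBlue x none ∈ twoTypeInvariant n ∧ ∀ f, twoTypePotential f (s.moveBlue x none) =
      ENNReal.ofReal (f (Multiset.card s.blue - 1) (s.red.count none - 1)) := by
  obtain ⟨h1, h2, h3⟩ := hs
  have hr' : 0 < s.red.count none := Multiset.count_pos.2 hr
  have hb : s.blue.count none = 0 := by omega
  rw [TwoTypeState.moveBlue, if_pos hr]
  constructor
  · refine ⟨?_, ?_, ?_⟩ <;>
      simp [Multiset.card_erase_of_mem, hx, hr, Multiset.count_erase_of_ne hx0.symm, hb] <;> omega
  · intro f
    simp [twoTypePotential, Multiset.card_erase_of_mem, hx, Multiset.count_erase_of_ne hx0.symm, hb]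

lemma moveBlue_leaf_of_notMem {s : TwoTypeState (StarVertex n)} (hs : s ∈ twoTypeInvariant n)
    {x : StarVertex n} (hx : x ∈ s.blue) (hx0 : x ≠ none) (hr : none ∉ s.red) :
    s.moveBlue x none ∈ twoTypeInvariant n ∧ ∀ f, twoTypePotential f (s.moveBlue x none) =
      ENNReal.ofReal (f (Multiset.card s.blue) (s.blue.count none + 1)) := by
  obtain ⟨h1, h2, h3⟩ := hs
  have hr' : s.red.count none = 0 := Multiset.count_eq_zero.2 hr
  have hc : 0 < Multiset.card s.blue := Multiset.card_pos_iff_exists_mem.2 ⟨x, hx⟩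
  have hc' : Multiset.card s.blue - 1 + 1 = Multiset.card s.blue := by omega
  rw [TwoTypeState.moveBlue, if_neg hr]
  constructor
  · refine ⟨?_, ?_, Or.inr hr'⟩ <;>
      simp [Multiset.card_erase_of_mem, hx] <;> omega
  · intro f
    simp [twoTypePotential, Multiset.card_erase_of_mem, hx, Multiset.count_erase_of_ne hx0.symm, hr',
      hc']

lemma moveBlue_core_of_mem {s : TwoTypeState (StarVertex n)} (hs : s ∈ twoTypeInvariant n)
    (hx : none ∈ s.blue) {y : StarVertex n} (hy0 : y ≠ none) (hr : y ∈ s.red) :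
    s.moveBlue none y ∈ twoTypeInvariant n ∧ ∀ f, twoTypePotential f (s.moveBlue none y) =
      ENNReal.ofReal (f (Multiset.card s.blue - 1) (s.blue.count none - 1)) := by
  obtain ⟨h1, h2, h3⟩ := hs
  have hb' : 0 < s.blue.count none := Multiset.count_pos.2 hx
  have hr0 : s.red.count none = 0 := by omega
  rw [TwoTypeState.moveBlue, if_pos hr]
  constructor
  · refine ⟨?_, ?_, ?_⟩ <;>
      simp [Multiset.card_erase_of_mem, hx, hr, Multiset.count_erase_of_ne hy0.symm, hr0] <;> omega
  · intro f
    simp [twoTypePotential, Multiset.card_erase_of_mem, hx, Multiset.count_erase_of_ne hy0.symm, hr0]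

lemma moveBlue_core_of_notMem {s : TwoTypeState (StarVertex n)} (hs : s ∈ twoTypeInvariant n)
    (hx : none ∈ s.blue) {y : StarVertex n} (hy0 : y ≠ none) (hr : y ∉ s.red) :
    s.moveBlue none y ∈ twoTypeInvariant n ∧ ∀ f, twoTypePotential f (s.moveBlue none y) =
      ENNReal.ofReal (f (Multiset.card s.blue) (s.blue.count none - 1)) := by
  obtain ⟨h1, h2, h3⟩ := hs
  have hb' : 0 < s.blue.count none := Multiset.count_pos.2 hx
  have hr0 : s.red.count none = 0 := by omega
  have hc : 0 < Multiset.card s.blue := Multiset.card_pos_iff_exists_mem.2 ⟨none, hx⟩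
  have hc' : Multiset.card s.blue - 1 + 1 = Multiset.card s.blue := by omega
  rw [TwoTypeState.moveBlue, if_neg hr]
  constructor
  · refine ⟨?_, ?_, Or.inr hr0⟩ <;>
      simp [Multiset.card_erase_of_mem, hx] <;> omega
  · intro f
    simp [twoTypePotential, Multiset.card_erase_of_mem, hx, Multiset.count_cons_of_ne hy0.symm, hr0,
      hc']

lemma ne_zero_of_mem_blue {s : TwoTypeState (StarVertex n)} (hs : s ∈ twoTypeInvariant n)
    {x : StarVertex n} (hx : x ∈ s.blue) : n ≠ 0 := by
  have := Multiset.card_pos_iff_exists_mem.2 ⟨x, hx⟩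
  have := hs.2.1
  omega

lemma blueStep_mem_invariant {s : TwoTypeState (StarVertex n)} (hs : s ∈ twoTypeInvariant n)
    {s' : TwoTypeState (StarVertex n)} (hs' : s' ∈ (blueStep (star n) s).support) :
    s' ∈ twoTypeInvariant n := by
  by_cases h : s.blue ≠ 0
  · rw [blueStep, dif_pos h] at hs'
    simp only [PMF.support_bind, PMF.support_map, Set.mem_iUnion, Set.mem_image,
      mem_support_ofMultiset] at hs'
    obtain ⟨x, hx, y, hy, rfl⟩ := hs'
    by_cases hx0 : x = none
    · subst hx0
      rw [walkStep_star_core (ne_zero_of_mem_blue hs hx), PMF.mem_support_uniformOfFinset_iff,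
        Finset.mem_erase] at hy
      by_cases hr : y ∈ s.red
      · exact (moveBlue_core_of_mem hs hx hy.1 hr).1
      · exact (moveBlue_core_of_notMem hs hx hy.1 hr).1
    · rw [walkStep_star_leaf hx0, PMF.mem_support_pure_iff] at hy
      subst hy
      by_cases hr : none ∈ s.red
      · exact (moveBlue_leaf_of_mem hs hx hx0 hr).1
      · exact (moveBlue_leaf_of_notMem hs hx hx0 hr).1
  · rw [blueStep, dif_neg h, PMF.mem_support_pure_iff] at hs'
    exact hs' ▸ hs

lemma twoTypeStep_mem_invariant (p : unitInterval) {s : TwoTypeState (StarVertex n)}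
    (hs : s ∈ twoTypeInvariant n) {s' : TwoTypeState (StarVertex n)}
    (hs' : s' ∈ (twoTypeStep (star n) p s).support) : s' ∈ twoTypeInvariant n := by
  simp only [twoTypeStep, PMF.support_bind, Set.mem_iUnion] at hs'
  obtain ⟨b, -, hb⟩ := hs'
  cases b with
  | true => exact blueStep_mem_invariant hs hb
  | false =>
    rw [if_neg (by simp), redStep_eq, PMF.support_map] at hb
    obtain ⟨u, hu, rfl⟩ := hb
    exact swap_mem_twoTypeInvariant
      (blueStep_mem_invariant (swap_mem_twoTypeInvariant hs) hu)

lemma twoTypeInit_mem_invariant : twoTypeInit n ∈ twoTypeInvariant n := by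
  refine ⟨?_, ?_, Or.inl ?_⟩ <;> simp [twoTypeInit]

/-- If red particles occupy the core, then every blue particle sits at a leaf, and its move to the core
annihilates it together with a red particle. -/
lemma pmfExp_blueStep_of_red_core {s : TwoTypeState (StarVertex n)}
    (hs : s ∈ twoTypeInvariant n) (hm : s.blue ≠ 0) (hr : none ∈ s.red) (f : ℕ → ℕ → ℝ) :
    pmfExp (blueStep (star n) s) (twoTypePotential f) =
      ENNReal.ofReal (f (Multiset.card s.blue - 1) (s.red.count none - 1)) := by
  have hb : none ∉ s.blue := by
    have := Multiset.count_pos.2 hr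
    rw [← Multiset.count_eq_zero]
    have := hs.2.2
    omega
  rw [blueStep, dif_pos hm, pmfExp_bind, ← pmfExp_const (PMF.ofMultiset s.blue hm)
    (ENNReal.ofReal _)]
  refine pmfExp_congr fun x hx => ?_
  rw [mem_support_ofMultiset] at hx
  have hx0 : x ≠ none := fun h => hb (h ▸ hx)
  rw [pmfExp_map, walkStep_star_leaf hx0, pmfExp_pure, (moveBlue_leaf_of_mem hs hx hx0 hr).2]

/-- If no red particle is at the core, then the sampled blue particle either joins the core, or leaves it
for a uniformly chosen leaf; `q` is the fraction of the leaves that are occupied by red particles. -/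
lemma pmfExp_blueStep_of_no_red_core {s : TwoTypeState (StarVertex n)}
    (hs : s ∈ twoTypeInvariant n) (hm : s.blue ≠ 0) (hr : none ∉ s.red) {f : ℕ → ℕ → ℝ}
    (hf : ∀ m k, k ≤ 2 * m → 0 ≤ f m k) :
    ∃ q : ℝ, 0 ≤ q ∧ q ≤ 1 / 2 ∧
      ∀ m k, Multiset.card s.blue = m → s.blue.count none = k →
      pmfExp (blueStep (star n) s) (twoTypePotential f) =
        ENNReal.ofReal ((1 - k / m) * f m (k + 1) +
          k / m * (q * f (m - 1) (k - 1) + (1 - q) * f m (k - 1))) := by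
  obtain ⟨x₀, hx₀⟩ := Multiset.exists_mem_of_ne_zero hm
  have hn := ne_zero_of_mem_blue hs hx₀
  have hn' : (0 : ℝ) < n := by exact_mod_cast Nat.pos_of_ne_zero hn
  set a := ((Finset.univ.erase (none : StarVertex n)).filter (· ∈ s.red)).card with ha
  have han : (a : ℝ) ≤ n := by
    have h1 : a ≤ s.red.toFinset.card := by
      refine Finset.card_le_card fun y hy => ?_
      simpa using (Finset.mem_filter.1 hy).2
    have h2 := Multiset.toFinset_card_le s.red
    have h3 := hs.1
    have h4 := hs.2.1
    exact_mod_cast (by omega : a ≤ n)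
  have hq : (a : ℝ) / (2 * n) ≤ 1 / 2 := by
    rw [div_le_iff₀ (by positivity)]; linarith
  refine ⟨a / (2 * n), by positivity, hq, ?_⟩
  rintro m k hmc hkc
  have hkm : k ≤ m := hmc ▸ hkc ▸ Multiset.count_le_card none s.blue
  have hm0 : 0 < m := hmc ▸ Multiset.card_pos.2 hm
  have hm0' : (0 : ℝ) < m := by exact_mod_cast hm0
  have hu := hf (m - 1) (k - 1) (by omega)
  have hv := hf m (k - 1) (by omega)
  have hw := hf m (k + 1) (by omega)
  have h1q : (0 : ℝ) ≤ 1 - a / (2 * n) := by linarith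
  have hmk : (0 : ℝ) ≤ (m - k : ℕ) := by positivity
  rw [blueStep, dif_pos hm, pmfExp_bind, pmfExp_ofMultiset,
    sum_map_of_eq_or_ne s.blue none _ (ENNReal.ofReal (a / (2 * n) * f (m - 1) (k - 1) +
      (1 - a / (2 * n)) * f m (k - 1))) (ENNReal.ofReal (f m (k + 1))), hmc, hkc]
  · have h2 : 0 ≤ a / (2 * n) * f (m - 1) (k - 1) + (1 - a / (2 * n)) * f m (k - 1) := by
      positivity
    generalize a / (2 * n) * f (m - 1) (k - 1) + (1 - a / (2 * n)) * f m (k - 1) = w at h2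
    have h1 : ((1 - k / m) * f m (k + 1) + k / m * w : ℝ) =
        (m : ℝ)⁻¹ * (k * w + (m - k : ℕ) * f m (k + 1)) := by
      push_cast [hkm]
      field_simp
      ring
    rw [h1, ENNReal.ofReal_mul (by positivity), ENNReal.ofReal_add (by positivity) (by positivity),
      ENNReal.ofReal_mul (by positivity), ENNReal.ofReal_mul hmk,
      ENNReal.ofReal_inv_of_pos hm0']
    simp only [ENNReal.ofReal_natCast]
  · intro hx
    rw [pmfExp_map, ha]
    refine pmfExp_walkStep_star_core hn (· ∈ s.red) hu hv (fun y hy hyr => ?_) fun y hy hyr => ?_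
    · rw [(moveBlue_core_of_mem hs hx hy hyr).2, hmc, hkc]
    · rw [(moveBlue_core_of_notMem hs hx hy hyr).2, hmc, hkc]
  · intro x hx hx0
    rw [pmfExp_map, walkStep_star_leaf hx0, pmfExp_pure, (moveBlue_leaf_of_notMem hs hx hx0 hr).2,
      hmc, hkc]

lemma pmfExp_redStep {s : TwoTypeState (StarVertex n)} (hs : s ∈ twoTypeInvariant n)
    (f : ℕ → ℕ → ℝ) : pmfExp (redStep (star n) s) (twoTypePotential f) =
      pmfExp (blueStep (star n) s.swap) (twoTypePotential f) := by
  rw [redStep_eq, pmfExp_map]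
  exact pmfExp_congr fun u hu => twoTypePotential_swap f
    (blueStep_mem_invariant (swap_mem_twoTypeInvariant hs) hu)

lemma pmfExp_twoTypeStep_half {s : TwoTypeState (StarVertex n)} (hs : s ∈ twoTypeInvariant n)
    (f : ℕ → ℕ → ℝ) : pmfExp (twoTypeStep (star n) half s) (twoTypePotential f) =
      ENNReal.ofReal (1 / 2) * pmfExp (blueStep (star n) s) (twoTypePotential f) +
      ENNReal.ofReal (1 / 2) * pmfExp (blueStep (star n) s.swap) (twoTypePotential f) := by
  rw [twoTypeStep, pmfExp_bind, pmfExp, tsum_bool, ← pmfExp_redStep hs]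
  have h1 : (1 - 1 / 2 : ℝ) = 1 / 2 := by norm_num
  have h2 : (half : ℝ) = 1 / 2 := rfl
  simp only [colour, PMF.ofFintype_apply, h2, h1, if_true, Bool.false_eq_true, if_false]
  rw [add_comm]

/-- One step of the two-type system from a state with an empty core. -/
lemma transition_twoType_core_empty {s : TwoTypeState (StarVertex n)}
    (hs : s ∈ twoTypeInvariant n) (hm : s.blue ≠ 0) (hk : s.blue.count none + s.red.count none = 0)
    {f : ℕ → ℕ → ℝ} (hf : ∀ m k, k ≤ 2 * m → 0 ≤ f m k) :
    transition (twoTypeStep (star n) half) (twoTypePotential f) s =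
      ENNReal.ofReal (f (Multiset.card s.blue) 1) := by
  have hb : s.blue.count none = 0 := by omega
  have hr : s.red.count none = 0 := by omega
  have hm' : s.swap.blue ≠ 0 := by
    rw [← Multiset.card_pos] at hm ⊢
    exact hs.1 ▸ hm
  obtain ⟨q, -, -, h⟩ :=
    pmfExp_blueStep_of_no_red_core hs hm (Multiset.count_eq_zero.1 hr) hf
  obtain ⟨q', -, -, h'⟩ := pmfExp_blueStep_of_no_red_core (swap_mem_twoTypeInvariant hs) hm'
    (Multiset.count_eq_zero.1 hb) hf
  have h0 := h _ 0 rfl hb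
  have h0' := h' (Multiset.card s.blue) 0 hs.1.symm hr
  simp only [Nat.cast_zero, zero_div, sub_zero, one_mul, zero_mul, add_zero, zero_add] at h0 h0'
  rw [transition, pmfExp_twoTypeStep_half hs, h0, h0', ← add_mul,
    ← ENNReal.ofReal_add (by norm_num) (by norm_num)]
  norm_num

/-- The mean of `f` after one step from a state with `m` particles of each colour and `k ≥ 1` particles
at the core, if the colour absent from the core occupies a fraction `q` of the leaves. -/
noncomputable def twoTypeMean (f : ℕ → ℕ → ℝ) (q : ℝ) (m k : ℕ) : ℝ :=
  1 / 2 * f (m - 1) (k - 1) + 1 / 2 * ((1 - k / m) * f m (k + 1) +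
    k / m * (q * f (m - 1) (k - 1) + (1 - q) * f m (k - 1)))

/-- One step of the two-type system from a state with `k ≥ 1` particles at the core, where `m` is the
number of particles of each colour: with probability `1 / 2` the colour absent from the core is sampled,
and a pair is annihilated at the core. -/
lemma transition_twoType_core_occupied {s : TwoTypeState (StarVertex n)}
    (hs : s ∈ twoTypeInvariant n) (hm : s.blue ≠ 0) (hk : s.blue.count none + s.red.count none ≠ 0)
    {f : ℕ → ℕ → ℝ} (hf : ∀ m k, k ≤ 2 * m → 0 ≤ f m k) :
    ∃ q : ℝ, 0 ≤ q ∧ q ≤ 1 / 2 ∧ ∀ m k, Multiset.card s.blue = m →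
      s.blue.count none + s.red.count none = k →
      transition (twoTypeStep (star n) half) (twoTypePotential f) s =
      ENNReal.ofReal (twoTypeMean f q m k) := by
  have hm' : s.swap.blue ≠ 0 := by
    rw [← Multiset.card_pos] at hm ⊢
    exact hs.1 ▸ hm
  have key : ∀ q : ℝ, 0 ≤ q → q ≤ 1 / 2 → ∀ m k : ℕ, 0 < m → k ≤ m →
      ENNReal.ofReal (twoTypeMean f q m k) =
      ENNReal.ofReal (1 / 2) * ENNReal.ofReal (f (m - 1) (k - 1)) + ENNReal.ofReal (1 / 2) *
        ENNReal.ofReal ((1 - k / m) * f m (k + 1) +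
          k / m * (q * f (m - 1) (k - 1) + (1 - q) * f m (k - 1))) := by
    intro q hq hq' m k hm0 hkm
    have hu := hf (m - 1) (k - 1) (by omega)
    have hv := hf m (k - 1) (by omega)
    have hw := hf m (k + 1) (by omega)
    have h1q : (0 : ℝ) ≤ 1 - q := by linarith
    have hk1 : (0 : ℝ) ≤ 1 - k / m := by
      have : (k : ℝ) / m ≤ 1 := div_le_one_of_le₀ (by exact_mod_cast hkm) (by positivity)
      linarith
    rw [twoTypeMean, ENNReal.ofReal_add (by positivity) (by positivity),
      ENNReal.ofReal_mul (by norm_num),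
      ENNReal.ofReal_mul (p := 1 / 2) (by norm_num)]
  have hm0 := Multiset.card_pos.2 hm
  have hkb := Multiset.count_le_card none s.blue
  have hkr := Multiset.count_le_card none s.red
  rcases hs.2.2 with hb | hr
  · have hr : none ∈ s.red := Multiset.count_pos.1 (by omega)
    obtain ⟨q, hq, hq', h'⟩ := pmfExp_blueStep_of_no_red_core (swap_mem_twoTypeInvariant hs) hm'
      (Multiset.count_eq_zero.1 hb) hf
    refine ⟨q, hq, hq', fun m k hmc hkc => ?_⟩
    have hrk : s.red.count none = k := by omega
    rw [transition, pmfExp_twoTypeStep_half hs, pmfExp_blueStep_of_red_core hs hm hr,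
      h' m k (hs.1.symm.trans hmc) hrk, key q hq hq' m k (by omega) (by have := hs.1; omega), hmc,
      hrk]
  · have hb : none ∈ s.blue := Multiset.count_pos.1 (by omega)
    obtain ⟨q, hq, hq', h⟩ := pmfExp_blueStep_of_no_red_core hs hm (Multiset.count_eq_zero.1 hr) hf
    refine ⟨q, hq, hq', fun m k hmc hkc => ?_⟩
    have hbk : s.blue.count none = k := by omega
    have hmc' : Multiset.card s.swap.blue = m := hs.1.symm.trans hmc
    have hbk' : s.swap.red.count none = k := hbk
    rw [transition, pmfExp_twoTypeStep_half hs,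
      pmfExp_blueStep_of_red_core (swap_mem_twoTypeInvariant hs) hm' hb,
      h m k hmc hbk, key q hq hq' m k (by omega) (by omega), hmc', hbk', add_comm]

end TwoType

/-! ### Bounds on the expected time of the two-type system -/

section TwoTypeBounds

variable {n : ℕ}

/-- The states of the two-type system without particles. -/
def twoTypeEmpty (n : ℕ) : Set (TwoTypeState (StarVertex n)) := {s | s.blue = 0 ∧ s.red = 0}

lemma mem_twoTypeEmpty_iff {s : TwoTypeState (StarVertex n)} (hs : s ∈ twoTypeInvariant n) :
    s ∈ twoTypeEmpty n ↔ s.blue = 0 := by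
  refine ⟨fun h => h.1, fun h => ⟨h, ?_⟩⟩
  have := hs.1
  rwa [h, Multiset.card_zero, eq_comm, Multiset.card_eq_zero] at this

lemma twoTypeStep_of_mem_empty (p : unitInterval) {s : TwoTypeState (StarVertex n)}
    (hs : s ∈ twoTypeEmpty n) : twoTypeStep (star n) p s = PMF.pure s := by
  have hb : blueStep (star n) s = PMF.pure s := by rw [blueStep, dif_neg (by simpa using hs.1)]
  have hr : redStep (star n) s = PMF.pure s := by rw [redStep, dif_neg (by simpa using hs.2)]
  simp [twoTypeStep, hb, hr]

lemma expectedTimeTwo_eq_tsum (p : unitInterval) : expectedTimeTwo p n =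
    ∑' t, (transition (twoTypeStep (star n) p))^[t] ((twoTypeEmpty n)ᶜ.indicator 1)
      (twoTypeInit n) :=
  lintegral_firstTime _ _ fun _ hs => twoTypeStep_of_mem_empty p hs

lemma twoTypePotential_init (f : ℕ → ℕ → ℝ) :
    twoTypePotential f (twoTypeInit n) = ENNReal.ofReal (f n 0) := by
  simp [twoTypePotential, twoTypeInit]

lemma card_blue_bounds {s : TwoTypeState (StarVertex n)} (hs : s ∈ twoTypeInvariant n) :
    Multiset.card s.blue ≤ n ∧
      s.blue.count none + s.red.count none ≤ Multiset.card s.blue := by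
  have h1 := Multiset.count_le_card none s.blue
  have h2 := Multiset.count_le_card none s.red
  obtain ⟨h3, h4, h5⟩ := hs
  omega

lemma twoTypeMean_nonneg {f : ℕ → ℕ → ℝ} (hf : ∀ m k, k ≤ 2 * m → 0 ≤ f m k) {q : ℝ} (hq : 0 ≤ q)
    (hq' : q ≤ 1) {m k : ℕ} (hm : 0 < m) (hkm : k ≤ m) : 0 ≤ twoTypeMean f q m k := by
  have hu := hf (m - 1) (k - 1) (by omega)
  have hv := hf m (k - 1) (by omega)
  have hw := hf m (k + 1) (by omega)
  have h1q : (0 : ℝ) ≤ 1 - q := by linarith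
  have hk1 : (0 : ℝ) ≤ 1 - k / m := by
    have : (k : ℝ) / m ≤ 1 := div_le_one_of_le₀ (by exact_mod_cast hkm) (by positivity)
    linarith
  unfold twoTypeMean
  positivity

/-- A potential that decreases by at least `1` on average in every step bounds the expected time from
above. -/
lemma expectedTimeTwo_le {f : ℕ → ℕ → ℝ} (hf : ∀ m k, k ≤ 2 * m → 0 ≤ f m k)
    (h0 : ∀ m, 0 < m → m ≤ n → 1 + f m 1 ≤ f m 0)
    (h1 : ∀ m k q, 0 < k → k ≤ m → m ≤ n → 0 ≤ q → q ≤ 1 / 2 →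
      1 + twoTypeMean f q m k ≤ f m k) :
    expectedTimeTwo half n ≤ ENNReal.ofReal (f n 0) := by
  rw [expectedTimeTwo_eq_tsum, ← twoTypePotential_init]
  refine tsum_transition_le (I := twoTypeInvariant n)
    (fun s hs s' hs' => twoTypeStep_mem_invariant half hs hs') (fun s hs => ?_)
    twoTypeInit_mem_invariant
  by_cases hE : s ∈ twoTypeEmpty n
  · simp [transition, twoTypeStep_of_mem_empty half hE, pmfExp_pure, hE]
  rw [Set.indicator_of_mem (by exact hE), Pi.one_apply, ← ENNReal.ofReal_one]
  have hm : s.blue ≠ 0 := fun h => hE ((mem_twoTypeEmpty_iff hs).2 h)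
  have hm0 := Multiset.card_pos.2 hm
  obtain ⟨hmn, hkm⟩ := card_blue_bounds hs
  by_cases hk : s.blue.count none + s.red.count none = 0
  · rw [transition_twoType_core_empty hs hm hk hf, twoTypePotential, hk,
      ← ENNReal.ofReal_add zero_le_one (hf _ _ (by omega))]
    exact ENNReal.ofReal_le_ofReal (h0 _ hm0 hmn)
  · obtain ⟨q, hq, hq', h⟩ := transition_twoType_core_occupied hs hm hk hf
    rw [h _ _ rfl rfl, twoTypePotential, ← ENNReal.ofReal_add zero_le_one (twoTypeMean_nonneg hf hq
      (by linarith) hm0 hkm)]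
    exact ENNReal.ofReal_le_ofReal (h1 _ _ q (by omega) hkm hmn hq hq')

/-- A potential that decreases by at most `1` on average in every step bounds the expected time from
below. -/
lemma le_expectedTimeTwo {f : ℕ → ℕ → ℝ} (hf : ∀ m k, k ≤ 2 * m → 0 ≤ f m k) (hf0 : f 0 0 = 0)
    (h0 : ∀ m, 0 < m → m ≤ n → f m 0 ≤ 1 + f m 1)
    (h1 : ∀ m k q, 0 < k → k ≤ m → m ≤ n → 0 ≤ q → q ≤ 1 / 2 →
      f m k ≤ 1 + twoTypeMean f q m k) :
    ENNReal.ofReal (f n 0) ≤ expectedTimeTwo half n := by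
  rw [expectedTimeTwo_eq_tsum, ← twoTypePotential_init]
  refine le_tsum_transition (I := twoTypeInvariant n)
    (B := ∑ m ∈ Finset.range (n + 1), ∑ k ∈ Finset.range (n + 1), ENNReal.ofReal (f m k))
    (fun s hs s' hs' => twoTypeStep_mem_invariant half hs hs') ?_ (fun s hs => ?_) (fun s hs => ?_)
    twoTypeInit_mem_invariant
  · exact ENNReal.sum_ne_top.2 fun m _ => ENNReal.sum_ne_top.2 fun k _ => ENNReal.ofReal_ne_top
  · obtain ⟨hmn, hkm⟩ := card_blue_bounds hs
    by_cases hE : s ∈ twoTypeEmpty n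
    · have hb : s.blue = 0 := hE.1
      have hr : s.red = 0 := hE.2
      simp [twoTypePotential, hb, hr, hf0]
    · rw [Set.indicator_of_mem (by exact hE), Pi.one_apply, mul_one, twoTypePotential]
      refine le_trans ?_ (Finset.single_le_sum (f := fun m => ∑ k ∈ Finset.range (n + 1),
        ENNReal.ofReal (f m k)) (fun _ _ => zero_le) (Finset.mem_range.2 (Nat.lt_succ_of_le hmn)))
      exact Finset.single_le_sum (f := fun k => ENNReal.ofReal (f (Multiset.card s.blue) k))
        (fun _ _ => zero_le) (Finset.mem_range.2 (by omega))
  by_cases hE : s ∈ twoTypeEmpty n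
  · simp [transition, twoTypeStep_of_mem_empty half hE, pmfExp_pure]
  rw [Set.indicator_of_mem (by exact hE), Pi.one_apply, ← ENNReal.ofReal_one]
  have hm : s.blue ≠ 0 := fun h => hE ((mem_twoTypeEmpty_iff hs).2 h)
  have hm0 := Multiset.card_pos.2 hm
  obtain ⟨hmn, hkm⟩ := card_blue_bounds hs
  by_cases hk : s.blue.count none + s.red.count none = 0
  · rw [transition_twoType_core_empty hs hm hk hf, twoTypePotential, hk,
      ← ENNReal.ofReal_add zero_le_one (hf _ _ (by omega))]
    exact ENNReal.ofReal_le_ofReal (h0 _ hm0 hmn)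
  · obtain ⟨q, hq, hq', h⟩ := transition_twoType_core_occupied hs hm hk hf
    rw [h _ _ rfl rfl, twoTypePotential, ← ENNReal.ofReal_add zero_le_one (twoTypeMean_nonneg hf hq
      (by linarith) hm0 hkm)]
    exact ENNReal.ofReal_le_ofReal (h1 _ _ q (by omega) hkm hmn hq hq')

/-- The potential for the upper bound. The term `2 * m - k` counts the steps that would remain if no
particle ever left the core without being annihilated; the bracket bounds the number of
wasted jumps. The indicator of an empty core absorbs the drift of `k ^ 2 / 8` there, where `m` cannot
decrease. -/
noncomputable def upperPotential (r : ℝ) (m k : ℕ) : ℝ :=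
  2 * m - k + 2 * (((k : ℝ) ^ 2 / 8 + m / 2 + if k = 0 then 1 / 8 else 0) / r
    + r / 2 * (harmonic m : ℚ))

lemma twoTypeMean_upperPotential {r : ℝ} (hr : 0 < r) {m k : ℕ} {q : ℝ} (hk : 0 < k) (hkm : k ≤ m)
    (hq : 0 ≤ q) : 1 + twoTypeMean (upperPotential r) q m k ≤ upperPotential r m k := by
  obtain ⟨j, rfl⟩ : ∃ j, k = j + 1 := ⟨k - 1, by omega⟩
  obtain ⟨i, rfl⟩ : ∃ i, m = i + 1 := ⟨m - 1, by omega⟩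
  simp only [twoTypeMean, upperPotential, Nat.add_sub_cancel, harmonic_succ, Nat.succ_ne_zero,
    if_false]
  -- `d` indicates that the core becomes empty when one particle leaves it
  obtain ⟨d, hd, hd1⟩ : ∃ d : ℝ, (if j = 0 then 1 / 8 else 0 : ℝ) = d / 8 ∧ d ≤ 1 := by
    split_ifs
    · exact ⟨1, by norm_num, le_rfl⟩
    · exact ⟨0, by norm_num, zero_le_one⟩
  rw [hd]
  have hji : (j : ℝ) ≤ i := by exact_mod_cast Nat.le_of_succ_le_succ hkm
  have hj : (0 : ℝ) ≤ j := j.cast_nonneg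
  push_cast
  generalize ((harmonic i : ℚ) : ℝ) = h
  obtain ⟨M, hM⟩ : ∃ M : ℝ, M = i + 1 := ⟨_, rfl⟩
  obtain ⟨K, hK⟩ : ∃ K : ℝ, K = j + 1 := ⟨_, rfl⟩
  have hM0 : 0 < M := by linarith
  have hK0 : 0 < K := by linarith
  have hi' : (i : ℝ) = M - 1 := by linarith
  have hj' : (j : ℝ) = K - 1 := by linarith
  have hb : d * (1 / 2 + K / (2 * M)) ≤ 1 := by
    have h1 : K / (2 * M) ≤ 1 / 2 := by rw [div_le_iff₀ (by positivity)]; linarith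
    have h2 : 0 ≤ K / (2 * M) := by positivity
    nlinarith
  -- the slack in the drift inequality; its first term is the arithmetic-geometric mean inequality
  have hpos : 0 ≤ (K - r) ^ 2 / (2 * M * r) + K * q / M +
      2 / r * (K * q / (4 * M) + 1 / 8 * (1 - d * (1 / 2 + K / (2 * M)))) +
      r * K * q / (2 * M ^ 2) := by
    have : 0 ≤ 1 - d * (1 / 2 + K / (2 * M)) := by linarith
    positivity
  rw [← sub_nonneg]
  refine hpos.trans_eq ?_
  rw [hi', hj']
  simp only [sub_add_cancel]
  field_simp
  ring

lemma upperPotential_nonneg {r : ℝ} (hr : 0 < r) {m k : ℕ} (hkm : k ≤ 2 * m) :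
    0 ≤ upperPotential r m k := by
  have h1 : (0 : ℝ) ≤ 2 * m - k := by
    have : (k : ℝ) ≤ 2 * m := by exact_mod_cast hkm
    linarith
  have h2 : (0 : ℝ) ≤ (harmonic m : ℚ) := by
    exact_mod_cast Finset.sum_nonneg fun i _ => by positivity
  unfold upperPotential
  have h3 : (0 : ℝ) ≤ if k = 0 then 1 / 8 else 0 := by split_ifs <;> norm_num
  positivity

lemma expectedTimeTwo_half_le (n : ℕ) {r : ℝ} (hr : 0 < r) : expectedTimeTwo half n ≤
    ENNReal.ofReal (2 * n + (n + 1 / 4) / r + r * (harmonic n : ℚ)) := by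
  refine (expectedTimeTwo_le (f := upperPotential r) (fun m k => upperPotential_nonneg hr)
    (fun m _ _ => ?_) fun m k q hk hkm _ hq _ => twoTypeMean_upperPotential hr hk hkm hq).trans_eq ?_
  · simp only [upperPotential, if_true, Nat.one_ne_zero, if_false]
    refine le_of_eq ?_
    push_cast
    ring
  · congr 1
    simp only [upperPotential, if_true]
    push_cast
    ring

/-- The truncated quadratic function in the potential for the lower bound. The truncated subtraction
`K - k` makes it constant in `k` beyond `K`. -/
noncomputable def truncatedQuadratic (n K m k : ℕ) : ℝ :=
  max 0 ((((K - k : ℕ) : ℝ) ^ 2 - (n - m)) / (8 * K))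

/-- The truncated quadratic function does not decrease on average while the core is occupied: for `k ≤ K`
the mean increment of `(K - k) ^ 2` is at least `1`, and `m` decreases by at most `3 / 4` on average. -/
lemma le_twoTypeMean_truncatedQuadratic {K m k : ℕ} {q : ℝ} (hk : 0 < k) (hkm : k ≤ m)
    (hmn : m ≤ n) (hq : 0 ≤ q) (hq' : q ≤ 1 / 2) :
    truncatedQuadratic n K m k ≤ twoTypeMean (truncatedQuadratic n K) q m k := by
  have hb : ∀ m k, 0 ≤ truncatedQuadratic n K m k := fun m k => le_max_left _ _
  have hm0 : (0 : ℝ) < m := by exact_mod_cast hk.trans_le hkm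
  have hkm' : (k : ℝ) / m ≤ 1 := div_le_one_of_le₀ (by exact_mod_cast hkm) (by positivity)
  have hkm0 : 0 ≤ (k : ℝ) / m := by positivity
  have h1q : 0 ≤ 1 - q := by linarith
  have h1k : 0 ≤ 1 - (k : ℝ) / m := by linarith
  have hmn' : (m : ℝ) ≤ n := by exact_mod_cast hmn
  by_cases hpos : 0 < (((K - k : ℕ) : ℝ) ^ 2 - (n - m)) / (8 * K)
  · have hkK : k < K := by
      by_contra h
      rw [Nat.sub_eq_zero_of_le (by omega)] at hpos
      have : ((((0 : ℕ) : ℝ)) ^ 2 - (n - m)) / (8 * K) ≤ 0 :=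
        div_nonpos_of_nonpos_of_nonneg (by norm_num; linarith) (by positivity)
      linarith
    have hK0 : (0 : ℝ) < K := by exact_mod_cast (Nat.zero_le k).trans_lt hkK
    have hkK' : (k : ℝ) ≤ K := by exact_mod_cast hkK.le
    have e0 : ((K - k : ℕ) : ℝ) = K - k := by push_cast [hkK.le]; ring
    have e1 : ((K - (k - 1) : ℕ) : ℝ) = K - k + 1 := by
      rw [show K - (k - 1) = K - k + 1 by omega]; push_cast [hkK.le]; ring
    have e2 : ((K - (k + 1) : ℕ) : ℝ) = K - k - 1 := by
      rw [Nat.cast_sub hkK]; push_cast; ring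
    have e3 : ((m - 1 : ℕ) : ℝ) = m - 1 := by
      rw [Nat.cast_sub (by omega)]; push_cast; ring
    have f1 : (((K : ℝ) - k + 1) ^ 2 - (n - (m - 1))) / (8 * K) ≤
        truncatedQuadratic n K (m - 1) (k - 1) := by
      rw [← e1, ← e3]; exact le_max_right _ _
    have f2 : (((K : ℝ) - k - 1) ^ 2 - (n - m)) / (8 * K) ≤
        truncatedQuadratic n K m (k + 1) := by
      rw [← e2]; exact le_max_right _ _
    have f3 : (((K : ℝ) - k + 1) ^ 2 - (n - m)) / (8 * K) ≤
        truncatedQuadratic n K m (k - 1) := by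
      rw [← e1]; exact le_max_right _ _
    have hmean : 1 / 2 * ((((K : ℝ) - k + 1) ^ 2 - (n - (m - 1))) / (8 * K)) +
        1 / 2 * ((1 - k / m) * ((((K : ℝ) - k - 1) ^ 2 - (n - m)) / (8 * K)) +
          k / m * (q * ((((K : ℝ) - k + 1) ^ 2 - (n - (m - 1))) / (8 * K)) +
            (1 - q) * ((((K : ℝ) - k + 1) ^ 2 - (n - m)) / (8 * K)))) ≤
        twoTypeMean (truncatedQuadratic n K) q m k := by
      unfold twoTypeMean
      gcongr
    rw [truncatedQuadratic, max_eq_right hpos.le, e0]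
    refine le_trans ?_ hmean
    rw [← sub_nonneg]
    have h2 : 0 ≤ (1 / 2 * (1 - k / m * q) + 2 * (k / m) * (K - k)) / (8 * K) := by
      have : k / m * q ≤ 1 * (1 / 2) := mul_le_mul hkm' hq' hq zero_le_one
      have : 0 ≤ 1 - k / m * q := by linarith
      have : (0 : ℝ) ≤ K - k := by linarith
      positivity
    refine h2.trans_eq ?_
    field_simp
    ring
  · rw [truncatedQuadratic, max_eq_left (not_lt.1 hpos), twoTypeMean]
    have g1 := hb (m - 1) (k - 1)
    have g2 := hb m (k + 1)
    have g3 := hb m (k - 1)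
    positivity

/-- The potential for the lower bound. The coefficient of `k` is `1 / 2` instead of `1` because a jump out
of the core is wasted with probability at least `1 / 2`. -/
noncomputable def lowerPotential (n K m k : ℕ) : ℝ :=
  2 * m - k / 2 + 2 * truncatedQuadratic n K m k

lemma le_twoTypeMean_lowerPotential {K m k : ℕ} {q : ℝ} (hk : 0 < k) (hkm : k ≤ m)
    (hmn : m ≤ n) (hq : 0 ≤ q) (hq' : q ≤ 1 / 2) :
    lowerPotential n K m k ≤ 1 + twoTypeMean (lowerPotential n K) q m k := by
  have h := le_twoTypeMean_truncatedQuadratic (K := K) hk hkm hmn hq hq'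
  have hm0 : (0 : ℝ) < m := by exact_mod_cast hk.trans_le hkm
  have e3 : ((m - 1 : ℕ) : ℝ) = m - 1 := by
    rw [Nat.cast_sub (by omega)]; push_cast; ring
  have e4 : ((k - 1 : ℕ) : ℝ) = k - 1 := by
    rw [Nat.cast_sub (by omega)]; push_cast; ring
  have h2 : 1 + twoTypeMean (lowerPotential n K) q m k - lowerPotential n K m k =
      k / m * (1 / 2 - q) + 2 * (twoTypeMean (truncatedQuadratic n K) q m k -
        truncatedQuadratic n K m k) := by
    simp only [twoTypeMean, lowerPotential, e3, e4]
    push_cast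
    field_simp
    ring
  have h3 : 0 ≤ k / m * (1 / 2 - q) := mul_nonneg (by positivity) (by linarith)
  linarith

lemma le_expectedTimeTwo_half {K : ℕ} (hK : 0 < K) (hKn : K ^ 2 ≤ n) :
    ENNReal.ofReal (2 * n + K / 4) ≤ expectedTimeTwo half n := by
  have hK0 : (0 : ℝ) < K := by exact_mod_cast hK
  have hKn' : (K : ℝ) ^ 2 ≤ n := by exact_mod_cast hKn
  have h := le_expectedTimeTwo (n := n) (f := lowerPotential n K) (fun m k hkm => ?_) ?_
    (fun m _ _ => ?_) fun m k q hk hkm hmn hq hq' => le_twoTypeMean_lowerPotential hk hkm hmn hq hq'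
  · refine Eq.trans_le ?_ h
    congr 1
    rw [lowerPotential, truncatedQuadratic, max_eq_right]
    · push_cast
      simp only [Nat.sub_zero]
      field_simp
      ring
    · simp only [sub_self, sub_zero]
      positivity
  · have h1 : (k : ℝ) ≤ 2 * m := by exact_mod_cast hkm
    have h2 : 0 ≤ truncatedQuadratic n K m k := le_max_left _ _
    have h3 : (0 : ℝ) ≤ m := m.cast_nonneg
    unfold lowerPotential
    linarith
  · -- without particles the quadratic function is truncated to `0`, since `K ^ 2 ≤ n`
    rw [lowerPotential, truncatedQuadratic, max_eq_left]
    · simp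
    · refine div_nonpos_of_nonpos_of_nonneg ?_ (by positivity)
      simp only [Nat.sub_zero, Nat.cast_zero]
      linarith
  · have h1 : truncatedQuadratic n K m 0 ≤ truncatedQuadratic n K m 1 + 1 / 4 := by
      refine max_le (by have : 0 ≤ truncatedQuadratic n K m 1 := le_max_left _ _
                        linarith) ?_
      have h2 : (((K - 1 : ℕ) : ℝ) ^ 2 - (n - m)) / (8 * K) ≤ truncatedQuadratic n K m 1 :=
        le_max_right _ _
      refine le_trans ?_ (add_le_add_left h2 (1 / 4))
      rw [Nat.cast_sub hK, Nat.sub_zero, ← sub_nonneg]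
      have : (0 : ℝ) ≤ 1 / (8 * K) := by positivity
      refine this.trans_eq ?_
      push_cast
      field_simp
      ring
    unfold lowerPotential
    push_cast
    linarith

end TwoTypeBounds

/-! ### The one-type system on the star graph -/

section OneType

variable {n : ℕ}

/-- The states that the one-type system on the star can reach: the number of particles is even. -/
def oneTypeInvariant (n : ℕ) : Set (OneTypeState (StarVertex n)) := {s | Even s.occupied.card}

/-- The states of the one-type system without particles. -/
def oneTypeEmpty (n : ℕ) : Set (OneTypeState (StarVertex n)) := {s | s.occupied = ∅}

/-- The number of particles minus the number of particles at the core, plus a function of the number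
of particles. -/
noncomputable def oneTypePotential (g : ℕ → ℝ) (s : OneTypeState (StarVertex n)) : ℝ≥0∞ :=
  ENNReal.ofReal (s.occupied.card - (if none ∈ s.occupied then 1 else 0) + g s.occupied.card)

lemma ne_zero_of_two_le_card {s : OneTypeState (StarVertex n)} (hs : 2 ≤ s.occupied.card) :
    n ≠ 0 := by
  rintro rfl
  have := Finset.card_le_univ s.occupied
  simp at this
  omega

lemma move_leaf_of_core_empty {s : OneTypeState (StarVertex n)} {x : StarVertex n}
    (hx : x ∈ s.occupied) (hc : none ∉ s.occupied) :
    (s.move x none).occupied.card = s.occupied.card ∧ none ∈ (s.move x none).occupied := by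
  have h : none ∉ s.occupied.erase x := fun h => hc (Finset.mem_of_mem_erase h)
  rw [OneTypeState.move, if_neg h]
  have := Finset.card_pos.2 ⟨x, hx⟩
  exact ⟨by rw [Finset.card_insert_of_notMem h, Finset.card_erase_of_mem hx]; omega, by simp⟩

lemma move_leaf_of_core_occupied {s : OneTypeState (StarVertex n)} {x : StarVertex n}
    (hx : x ∈ s.occupied) (hx0 : x ≠ none) (hc : none ∈ s.occupied) :
    (s.move x none).occupied.card = s.occupied.card - 2 ∧ none ∉ (s.move x none).occupied := by
  have h : none ∈ s.occupied.erase x := Finset.mem_erase.2 ⟨hx0.symm, hc⟩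
  rw [OneTypeState.move, if_pos h]
  exact ⟨by rw [Finset.card_erase_of_mem h, Finset.card_erase_of_mem hx]; omega, by simp⟩

lemma move_core_of_mem {s : OneTypeState (StarVertex n)} {y : StarVertex n}
    (hc : none ∈ s.occupied) (hy0 : y ≠ none) (hy : y ∈ s.occupied) :
    (s.move none y).occupied.card = s.occupied.card - 2 ∧ none ∉ (s.move none y).occupied := by
  have h : y ∈ s.occupied.erase none := Finset.mem_erase.2 ⟨hy0, hy⟩
  rw [OneTypeState.move, if_pos h]
  exact ⟨by rw [Finset.card_erase_of_mem h, Finset.card_erase_of_mem hc]; omega, by simp⟩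

lemma move_core_of_notMem {s : OneTypeState (StarVertex n)} {y : StarVertex n}
    (hc : none ∈ s.occupied) (hy0 : y ≠ none) (hy : y ∉ s.occupied) :
    (s.move none y).occupied.card = s.occupied.card ∧ none ∉ (s.move none y).occupied := by
  have h : y ∉ s.occupied.erase none := fun h => hy (Finset.mem_of_mem_erase h)
  rw [OneTypeState.move, if_neg h]
  have := Finset.card_pos.2 ⟨none, hc⟩
  exact ⟨by rw [Finset.card_insert_of_notMem h, Finset.card_erase_of_mem hc]; omega,
    by simp [hy0.symm]⟩

lemma oneTypeStep_mem_invariant {s : OneTypeState (StarVertex n)} (hs : s ∈ oneTypeInvariant n)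
    {s' : OneTypeState (StarVertex n)} (hs' : s' ∈ (oneTypeStep (star n) s).support) :
    s' ∈ oneTypeInvariant n := by
  by_cases h : s.occupied.Nonempty
  · rw [oneTypeStep, dif_pos h] at hs'
    simp only [PMF.support_bind, PMF.support_map, Set.mem_iUnion, Set.mem_image,
      PMF.mem_support_uniformOfFinset_iff] at hs'
    obtain ⟨x, hx, y, hy, rfl⟩ := hs'
    have hs2 : Even (s.occupied.card - 2) := hs.tsub even_two
    have hpos : 2 ≤ s.occupied.card := by
      obtain ⟨c, hc⟩ := hs
      have := Finset.card_pos.2 h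
      omega
    rw [oneTypeInvariant, Set.mem_ofPred_eq]
    by_cases hx0 : x = none
    · subst hx0
      rw [walkStep_star_core (ne_zero_of_two_le_card hpos), PMF.mem_support_uniformOfFinset_iff,
        Finset.mem_erase] at hy
      by_cases hyo : y ∈ s.occupied
      · rwa [(move_core_of_mem hx hy.1 hyo).1]
      · rw [(move_core_of_notMem hx hy.1 hyo).1]; exact hs
    · rw [walkStep_star_leaf hx0, PMF.mem_support_pure_iff] at hy
      subst hy
      by_cases hc : none ∈ s.occupied
      · rwa [(move_leaf_of_core_occupied hx hx0 hc).1]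
      · rw [(move_leaf_of_core_empty hx hc).1]; exact hs
  · rw [oneTypeStep, dif_neg h, PMF.mem_support_pure_iff] at hs'
    exact hs' ▸ hs

lemma oneTypeInit_mem_invariant : oneTypeInit n ∈ oneTypeInvariant n := by
  rw [oneTypeInvariant, Set.mem_ofPred_eq, oneTypeInit, card_leaves]
  exact even_two_mul n

lemma oneTypeStep_of_mem_empty {s : OneTypeState (StarVertex n)} (hs : s ∈ oneTypeEmpty n) :
    oneTypeStep (star n) s = PMF.pure s := by
  have h : ¬ s.occupied.Nonempty := Finset.not_nonempty_iff_eq_empty.2 hs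
  rw [oneTypeStep, dif_neg h]

lemma expectedTimeOne_eq_tsum : expectedTimeOne n =
    ∑' t, (transition (oneTypeStep (star n)))^[t] ((oneTypeEmpty n)ᶜ.indicator 1)
      (oneTypeInit n) :=
  lintegral_firstTime _ _ fun _ hs => oneTypeStep_of_mem_empty hs

lemma oneTypePotential_init (g : ℕ → ℝ) :
    oneTypePotential g (oneTypeInit n) = ENNReal.ofReal (2 * n + g (2 * n)) := by
  simp [oneTypePotential, oneTypeInit, two_mul]

/-- One step of the one-type system from a state with an empty core. -/
lemma transition_oneType_core_empty {s : OneTypeState (StarVertex n)} (h : s.occupied.Nonempty)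
    (hc : none ∉ s.occupied) (g : ℕ → ℝ) :
    transition (oneTypeStep (star n)) (oneTypePotential g) s =
      ENNReal.ofReal (s.occupied.card - 1 + g s.occupied.card) := by
  rw [transition, oneTypeStep, dif_pos h, pmfExp_bind,
    ← pmfExp_const (PMF.uniformOfFinset s.occupied h) (ENNReal.ofReal _)]
  refine pmfExp_congr fun x hx => ?_
  rw [PMF.mem_support_uniformOfFinset_iff] at hx
  have hx0 : x ≠ none := fun h => hc (h ▸ hx)
  obtain ⟨h1, h2⟩ := move_leaf_of_core_empty hx hc
  rw [pmfExp_map, walkStep_star_leaf hx0, pmfExp_pure, oneTypePotential, if_pos h2, h1]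

/-- One step of the one-type system from a state with an occupied core: all particles survive with
probability `θ`, which is at most the probability that the particle at the core is sampled. -/
lemma transition_oneType_core_occupied {s : OneTypeState (StarVertex n)}
    (hs : s ∈ oneTypeInvariant n) (hc : none ∈ s.occupied) {g : ℕ → ℝ} (hg : ∀ N, 0 ≤ g N) :
    ∃ θ : ℝ, 0 ≤ θ ∧ θ ≤ 1 / s.occupied.card ∧
      transition (oneTypeStep (star n)) (oneTypePotential g) s =
        ENNReal.ofReal ((1 - θ) * (s.occupied.card - 2 + g (s.occupied.card - 2)) +
          θ * (s.occupied.card + g s.occupied.card)) := by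
  have hne : s.occupied.Nonempty := ⟨none, hc⟩
  have hpos : 2 ≤ s.occupied.card := by
    obtain ⟨c, hc⟩ := hs
    have := Finset.card_pos.2 hne
    omega
  have hn := ne_zero_of_two_le_card hpos
  have hn' : (0 : ℝ) < n := by exact_mod_cast Nat.pos_of_ne_zero hn
  set N := s.occupied.card with hN
  set a := ((Finset.univ.erase (none : StarVertex n)).filter (· ∈ s.occupied)).card with ha
  have hN2 : (2 : ℝ) ≤ N := by exact_mod_cast hpos
  have hcast : ((N - 2 : ℕ) : ℝ) = N - 2 := by push_cast [hpos]; ring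
  have hr : (a : ℝ) / (2 * n) ≤ 1 := by
    refine div_le_one_of_le₀ ?_ (by positivity)
    have h : a ≤ 2 * n := card_leaves (n := n) ▸ Finset.card_filter_le _ _
    exact_mod_cast h
  have hr0 : (0 : ℝ) ≤ a / (2 * n) := by positivity
  have hu : 0 ≤ (N : ℝ) - 2 + g (N - 2) := by have := hg (N - 2); linarith
  have hv : 0 ≤ (N : ℝ) + g N := by have := hg N; linarith
  refine ⟨(1 - a / (2 * n)) / N, div_nonneg (by linarith) (by positivity), ?_, ?_⟩
  · gcongr
    linarith
  have hmul : (s.occupied.val.map fun x =>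
        pmfExp ((walkStep (star n) x).map fun y => s.move x y) (oneTypePotential g)).sum =
      ((1 : ℕ) : ℝ≥0∞) * ENNReal.ofReal (a / (2 * n) * (N - 2 + g (N - 2)) +
        (1 - a / (2 * n)) * (N + g N)) + ((N - 1 : ℕ) : ℝ≥0∞) * ENNReal.ofReal (N - 2 + g (N - 2)) := by
    rw [sum_map_of_eq_or_ne s.occupied.val none _
      (ENNReal.ofReal (a / (2 * n) * (N - 2 + g (N - 2)) + (1 - a / (2 * n)) * (N + g N)))
      (ENNReal.ofReal (N - 2 + g (N - 2))),
      Multiset.count_eq_one_of_mem s.occupied.nodup hc]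
    · rfl
    · intro _
      rw [pmfExp_map, ha]
      refine pmfExp_walkStep_star_core hn (· ∈ s.occupied) hu hv (fun y hy hyo => ?_)
        fun y hy hyo => ?_
      · obtain ⟨h1, h2⟩ := move_core_of_mem hc hy hyo
        rw [oneTypePotential, if_neg h2, h1, sub_zero, ← hN, hcast]
      · obtain ⟨h1, h2⟩ := move_core_of_notMem hc hy hyo
        rw [oneTypePotential, if_neg h2, h1, sub_zero]
    · intro x hx hx0
      obtain ⟨h1, h2⟩ := move_leaf_of_core_occupied hx hx0 hc
      rw [pmfExp_map, walkStep_star_leaf hx0, pmfExp_pure, oneTypePotential, if_neg h2, h1, sub_zero,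
        ← hN, hcast]
  rw [transition, oneTypeStep, dif_pos hne, pmfExp_bind, pmfExp_uniformOfFinset, Finset.sum, hmul,
    ← hN]
  have hw : 0 ≤ a / (2 * n) * (N - 2 + g (N - 2)) + (1 - a / (2 * n)) * (N + g N) := by
    have : (0 : ℝ) ≤ 1 - a / (2 * n) := by linarith
    positivity
  have h1 : (1 - (1 - a / (2 * n)) / N) * (N - 2 + g (N - 2)) +
        (1 - a / (2 * n)) / N * (N + g N) =
      (N : ℝ)⁻¹ * ((1 : ℕ) * (a / (2 * n) * (N - 2 + g (N - 2)) + (1 - a / (2 * n)) * (N + g N)) +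
        ((N - 1 : ℕ) : ℝ) * (N - 2 + g (N - 2))) := by
    rw [Nat.cast_sub (by omega : 1 ≤ N)]
    push_cast
    field_simp
    ring
  rw [h1]
  generalize a / (2 * n) * (N - 2 + g (N - 2)) + (1 - a / (2 * n)) * (N + g N) = w at hw
  generalize (N : ℝ) - 2 + g (N - 2) = u at hu
  rw [ENNReal.ofReal_mul (p := (N : ℝ)⁻¹) (by positivity),
    ENNReal.ofReal_add (by positivity) (by positivity),
    ENNReal.ofReal_mul (p := ((1 : ℕ) : ℝ)) (by positivity),
    ENNReal.ofReal_mul (p := ((N - 1 : ℕ) : ℝ)) (by positivity),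
    ENNReal.ofReal_inv_of_pos (by positivity)]
  simp only [ENNReal.ofReal_natCast]

lemma two_le_card_of_notMem_empty {s : OneTypeState (StarVertex n)}
    (hs : s ∈ oneTypeInvariant n) (hE : s ∉ oneTypeEmpty n) : 2 ≤ s.occupied.card := by
  obtain ⟨c, hc⟩ := hs
  have := Finset.card_pos.2 (Finset.nonempty_iff_ne_empty.2 hE)
  omega

/-- With `N ≥ 2` particles, of which one is at the core, at most `1 / (N - 1)` steps per annihilated pair
are wasted on average, and each of them costs two additional steps. -/
lemma expectedTimeOne_le (n : ℕ) :
    expectedTimeOne n ≤ ENNReal.ofReal (2 * n + 4 * (harmonic (2 * n) : ℚ)) := by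
  have hg : ∀ N : ℕ, (0 : ℝ) ≤ 4 * (harmonic N : ℚ) := fun N => by
    have : (0 : ℝ) ≤ (harmonic N : ℚ) := by
      exact_mod_cast Finset.sum_nonneg fun i _ => by positivity
    positivity
  rw [expectedTimeOne_eq_tsum, ← oneTypePotential_init fun N => 4 * ((harmonic N : ℚ) : ℝ)]
  refine tsum_transition_le (I := oneTypeInvariant n)
    (fun s hs s' hs' => oneTypeStep_mem_invariant hs hs') (fun s hs => ?_)
    oneTypeInit_mem_invariant
  by_cases hE : s ∈ oneTypeEmpty n
  · simp [transition, oneTypeStep_of_mem_empty hE, pmfExp_pure, hE]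
  have h2 := two_le_card_of_notMem_empty hs hE
  rw [Set.indicator_of_mem (by exact hE), Pi.one_apply, ← ENNReal.ofReal_one]
  by_cases hc : none ∈ s.occupied
  · obtain ⟨θ, hθ, hθ', h⟩ := transition_oneType_core_occupied hs hc hg
    rw [h, oneTypePotential, if_pos hc]
    obtain ⟨N, hN⟩ : ∃ N, s.occupied.card = N + 2 := ⟨_, (Nat.sub_add_cancel h2).symm⟩
    rw [hN] at hθ' ⊢
    have h0 := hg N
    have h1 := hg (N + 2)
    have hN0 : (0 : ℝ) ≤ N := N.cast_nonneg
    have hM : (1 : ℝ) / (N + 2 : ℕ) ≤ 1 / 2 := by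
      push_cast
      exact one_div_le_one_div_of_le (by norm_num) (by linarith)
    have hθ1 : 0 ≤ 1 - θ := by linarith
    have hstep : 4 * ((harmonic N : ℚ) : ℝ) + 4 * (1 / (N + 2 : ℕ)) ≤
        4 * ((harmonic (N + 2) : ℚ) : ℝ) := by
      rw [harmonic_succ, harmonic_succ]
      push_cast
      have : (0 : ℝ) ≤ ((N : ℝ) + 1)⁻¹ := by positivity
      have h3 : ((N : ℝ) + 1 + 1)⁻¹ = 1 / (N + 2) := by rw [one_div]; congr 1; ring
      linarith
    rw [← ENNReal.ofReal_add zero_le_one]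
    · refine ENNReal.ofReal_le_ofReal ?_
      simp only [Nat.add_sub_cancel]
      -- the increment of the harmonic term outweighs the cost `2 * θ` of a failed jump
      have h4 : (1 - θ) * (4 * ((harmonic N : ℚ) : ℝ) + 4 * (1 / (N + 2 : ℕ))) ≤
        (1 - θ) * (4 * ((harmonic (N + 2) : ℚ) : ℝ)) := mul_le_mul_of_nonneg_left hstep hθ1
      have h5 : 1 / 2 * (4 * (1 / (N + 2 : ℕ) : ℝ)) ≤ (1 - θ) * (4 * (1 / (N + 2 : ℕ))) :=
        mul_le_mul_of_nonneg_right (by linarith) (by positivity)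
      push_cast at *
      nlinarith
    · simp only [Nat.add_sub_cancel]
      push_cast
      have : (0 : ℝ) ≤ (N : ℝ) + 2 - 2 := by linarith
      positivity
  · rw [transition_oneType_core_empty (Finset.card_pos.1 (by omega)) hc, oneTypePotential, if_neg hc,
      ← ENNReal.ofReal_add zero_le_one]
    · exact ENNReal.ofReal_le_ofReal (by linarith)
    · have h1 := hg s.occupied.card
      have : (2 : ℝ) ≤ s.occupied.card := by exact_mod_cast h2
      linarith

lemma le_expectedTimeOne (n : ℕ) : ENNReal.ofReal (2 * n) ≤ expectedTimeOne n := by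
  have h0 := oneTypePotential_init (n := n) fun _ => 0
  rw [add_zero] at h0
  rw [expectedTimeOne_eq_tsum, ← h0]
  refine le_tsum_transition (I := oneTypeInvariant n)
    (B := ENNReal.ofReal (2 * n + 1))
    (fun s hs s' hs' => oneTypeStep_mem_invariant hs hs') ENNReal.ofReal_ne_top (fun s hs => ?_)
    (fun s hs => ?_) oneTypeInit_mem_invariant
  · by_cases hE : s ∈ oneTypeEmpty n
    · have : s.occupied = ∅ := hE
      simp [oneTypePotential, this]
    · rw [Set.indicator_of_mem (by exact hE), Pi.one_apply, mul_one, oneTypePotential]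
      refine ENNReal.ofReal_le_ofReal ?_
      have h1 : (s.occupied.card : ℝ) ≤ 2 * n + 1 := by
        have := Finset.card_le_univ s.occupied
        simp only [Fintype.card_option, Fintype.card_sum, Fintype.card_fin] at this
        exact_mod_cast this.trans_eq (by ring)
      split_ifs <;> linarith
  by_cases hE : s ∈ oneTypeEmpty n
  · simp [transition, oneTypeStep_of_mem_empty hE, pmfExp_pure]
  have h2 := two_le_card_of_notMem_empty hs hE
  have h2' : (2 : ℝ) ≤ s.occupied.card := by exact_mod_cast h2
  rw [Set.indicator_of_mem (by exact hE), Pi.one_apply, ← ENNReal.ofReal_one]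
  by_cases hc : none ∈ s.occupied
  · obtain ⟨θ, hθ, hθ', h⟩ := transition_oneType_core_occupied (g := fun _ => 0) hs hc fun _ => le_rfl
    have h3 : ((1 - θ) * (s.occupied.card - 2 + 0) + θ * (s.occupied.card + 0) : ℝ) =
        s.occupied.card - 2 + 2 * θ := by ring
    rw [h, h3, oneTypePotential, if_pos hc, ← ENNReal.ofReal_add zero_le_one (by linarith)]
    exact ENNReal.ofReal_le_ofReal (by linarith)
  · rw [transition_oneType_core_empty (Finset.card_pos.1 (by omega)) hc, oneTypePotential, if_neg hc,
      ← ENNReal.ofReal_add zero_le_one (by linarith)]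
    exact ENNReal.ofReal_le_ofReal (by linarith)

end OneType

/-! ### Asymptotics -/

lemma BigO.of_eventually_le {f g : ℕ → ℝ} (M : ℝ) (h : ∀ᶠ n in atTop, f n / g n ≤ M) :
    BigO f g := by
  refine lt_of_le_of_lt (limsup_le_of_le (by isBoundedDefault) ?_) (EReal.coe_lt_top M)
  filter_upwards [h] with n hn
  exact_mod_cast hn

lemma BigOmega.of_eventually_le {f g : ℕ → ℝ} {δ : ℝ} (hδ : 0 < δ)
    (h : ∀ᶠ n in atTop, δ ≤ f n / g n) : BigOmega f g := by
  refine lt_of_lt_of_le (EReal.coe_pos.2 hδ) (le_liminf_of_le (by isBoundedDefault) ?_)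
  filter_upwards [h] with n hn
  exact_mod_cast hn

lemma expectedTimeTwo_half_ne_top (n : ℕ) : expectedTimeTwo half n ≠ ⊤ :=
  ne_top_of_le_ne_top ENNReal.ofReal_ne_top (expectedTimeTwo_half_le n one_pos)

lemma expectedTimeOne_ne_top (n : ℕ) : expectedTimeOne n ≠ ⊤ :=
  ne_top_of_le_ne_top ENNReal.ofReal_ne_top (expectedTimeOne_le n)

lemma harmonic_cast_nonneg (n : ℕ) : (0 : ℝ) ≤ (harmonic n : ℚ) := by
  exact_mod_cast Finset.sum_nonneg fun i _ => by positivity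

lemma toReal_expectedTimeTwo_le {n : ℕ} (hn : 0 < n) : (expectedTimeTwo half n).toReal ≤
    2 * n + 2 * √n + √n * Real.log n + 1 := by
  have hn1 : (1 : ℝ) ≤ n := by exact_mod_cast hn
  have hs1 : 1 ≤ √(n : ℝ) := Real.one_le_sqrt.2 hn1
  have hs : 0 < √(n : ℝ) := by linarith
  have hss : √(n : ℝ) * √n = n := Real.mul_self_sqrt (by linarith)
  have hH := harmonic_cast_nonneg n
  refine (ENNReal.toReal_le_of_le_ofReal (by positivity) (expectedTimeTwo_half_le n hs)).trans ?_
  have h1 : ((n : ℝ) + 1 / 4) / √n ≤ √n + 1 := by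
    rw [div_le_iff₀ hs]
    nlinarith
  have h2 := mul_le_mul_of_nonneg_left (harmonic_le_one_add_log n) hs.le
  linarith

lemma le_toReal_expectedTimeTwo {n : ℕ} (hn : 0 < n) :
    2 * n + (√n - 1) / 4 ≤ (expectedTimeTwo half n).toReal := by
  have h := le_expectedTimeTwo_half (n := n) (Nat.sqrt_pos.2 hn) (Nat.sqrt_le' n)
  rw [ENNReal.ofReal_le_iff_le_toReal (expectedTimeTwo_half_ne_top n)] at h
  have h1 : √(n : ℝ) ≤ Nat.sqrt n + 1 := Real.real_sqrt_le_nat_sqrt_succ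
  linarith

lemma toReal_expectedTimeOne_le {n : ℕ} (hn : 0 < n) :
    (expectedTimeOne n).toReal ≤ 2 * n + 8 + 4 * Real.log n := by
  have hH := harmonic_cast_nonneg (2 * n)
  have hn0 : (n : ℝ) ≠ 0 := by positivity
  refine (ENNReal.toReal_le_of_le_ofReal (by positivity) (expectedTimeOne_le n)).trans ?_
  have h1 := harmonic_le_one_add_log (2 * n)
  push_cast at h1
  rw [Real.log_mul two_ne_zero hn0] at h1
  have h2 : Real.log 2 < 1 := by linarith [Real.log_two_lt_d9]
  linarith

lemma le_toReal_expectedTimeOne (n : ℕ) : 2 * n ≤ (expectedTimeOne n).toReal :=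
  (ENNReal.ofReal_le_iff_le_toReal (expectedTimeOne_ne_top n)).1 (le_expectedTimeOne n)

lemma tendsto_sqrt_natCast_atTop : Tendsto (fun n : ℕ => √(n : ℝ)) atTop atTop :=
  Real.tendsto_sqrt_atTop.comp tendsto_natCast_atTop_atTop

lemma eventually_log_le_mul_sqrt {ε : ℝ} (hε : 0 < ε) :
    ∀ᶠ n : ℕ in atTop, Real.log n ≤ ε * √(n : ℝ) := by
  have h := ((isLittleO_log_rpow_atTop (r := 1 / 2) (by norm_num)).comp_tendsto
    (tendsto_natCast_atTop_atTop (R := ℝ))).def hε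
  filter_upwards [h] with n hn
  simp only [Function.comp_apply, ← Real.sqrt_eq_rpow, Real.norm_eq_abs,
    abs_of_nonneg (Real.sqrt_nonneg _)] at hn
  exact (le_abs_self _).trans hn

lemma one_le_log {n : ℕ} (hn : 3 ≤ n) : 1 ≤ Real.log n := by
  rw [Real.le_log_iff_exp_le (by positivity)]
  have : (3 : ℝ) ≤ n := by exact_mod_cast hn
  linarith [Real.exp_one_lt_d9]

lemma rpow_lt_one_div_four : ((32 * Real.pi) ^ (-(1 / 2) : ℝ) : ℝ) < 1 / 4 := by
  have hpi := Real.pi_gt_three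
  rw [Real.rpow_neg (by positivity), ← Real.sqrt_eq_rpow, ← one_div]
  refine one_div_lt_one_div_of_lt (by norm_num) ?_
  rw [Real.lt_sqrt (by norm_num)]
  linarith

end Annihilation

theorem mainTheorem1 :
    -- all the expectations are finite
    (∀ n : ℕ, Annihilation.expectedTimeTwo Annihilation.half n ≠ ⊤ ∧
      Annihilation.expectedTimeOne n ≠ ⊤) ∧
    -- (i)
    (∀ C : ℝ, C < (32 * Real.pi) ^ (-(1 / 2) : ℝ) →
      Annihilation.BigOmega
        (fun n => (Annihilation.expectedTimeTwo Annihilation.half n).toReal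
          - (2 * (n : ℝ) + C * Real.sqrt n))
        (fun _ => 1)) ∧
    -- (ii)
    (∃ c : ℝ, 0 < c ∧
      Annihilation.BigO
        (fun n => (Annihilation.expectedTimeTwo Annihilation.half n).toReal
          - (2 * (n : ℝ) + c * Real.sqrt n * Real.log n))
        (fun _ => 1)) ∧
    -- the excess over the one-type system
    Annihilation.BigOmega
      (fun n => (Annihilation.expectedTimeTwo Annihilation.half n).toReal
        - (Annihilation.expectedTimeOne n).toReal)
      (fun n => Real.sqrt n) ∧
    Annihilation.BigO
      (fun n => (Annihilation.expectedTimeTwo Annihilation.half n).toReal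
        - (Annihilation.expectedTimeOne n).toReal)
      (fun n => Real.sqrt n * Real.log n) := by
  refine ⟨fun n => ⟨Annihilation.expectedTimeTwo_half_ne_top n,
    Annihilation.expectedTimeOne_ne_top n⟩, fun C hC => ?_, ⟨3, by norm_num, ?_⟩, ?_, ?_⟩
  · have hC' : 0 < 1 / 4 - C := by linarith [Annihilation.rpow_lt_one_div_four]
    refine Annihilation.BigOmega.of_eventually_le one_pos ?_
    filter_upwards [eventually_gt_atTop 0,
      Annihilation.tendsto_sqrt_natCast_atTop.eventually_ge_atTop (2 / (1 / 4 - C))] with n hn hs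
    rw [div_le_iff₀ hC'] at hs
    have := Annihilation.le_toReal_expectedTimeTwo hn
    rw [div_one]
    linarith
  · refine Annihilation.BigO.of_eventually_le 1 ?_
    filter_upwards [eventually_ge_atTop 3] with n hn
    have h1 := Annihilation.toReal_expectedTimeTwo_le (by omega : 0 < n)
    have h2 := mul_le_mul_of_nonneg_left (Annihilation.one_le_log hn) (Real.sqrt_nonneg n)
    rw [div_one]
    linarith
  · refine Annihilation.BigOmega.of_eventually_le (δ := 1 / 8) (by norm_num) ?_
    filter_upwards [eventually_gt_atTop 0,
      Annihilation.tendsto_sqrt_natCast_atTop.eventually_ge_atTop 1000,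
      Annihilation.eventually_log_le_mul_sqrt (ε := 1 / 64) (by norm_num)] with n hn hs hlog
    have h1 := Annihilation.le_toReal_expectedTimeTwo hn
    have h2 := Annihilation.toReal_expectedTimeOne_le hn
    rw [le_div_iff₀ (by linarith)]
    linarith
  · refine Annihilation.BigO.of_eventually_le 4 ?_
    filter_upwards [eventually_ge_atTop 3] with n hn
    have h1 := Annihilation.toReal_expectedTimeTwo_le (by omega : 0 < n)
    have h2 := Annihilation.le_toReal_expectedTimeOne n
    have h3 := Annihilation.one_le_log hn
    have h4 := mul_le_mul_of_nonneg_left h3 (Real.sqrt_nonneg n)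
    have h5 : 1 ≤ √(n : ℝ) := Real.one_le_sqrt.2 (by exact_mod_cast (by omega : 1 ≤ n))
    rw [div_le_iff₀ (by positivity)]
    linarith
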